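/- Let $A\bullet B=\operatorname{tr}(AB)$ for symmetric $n\times n$ matrices and $N=\{1,\dots,n\}$. Consider semidefinite feasibility problems (SDPs) $$A_i\bullet X=b_i\ (i=1,\dots,m),\qquad X\succeq 0 \tag{P}$$ with $A_1,\dots,A_m$ real symmetric $n\times n$ matrices and $b\in\mathbb R^m$. (P) is *weakly infeasible* if it has no feasible solution, but the set of symmetric $X$ with $A_i\bullet X=b_i$ for all $i$ has distance zero to the cone of positive semidefinite matrices (the distance of the empty set to the cone is $+\infty$). To *reformulate* (P) means to apply finitely many (possibly no) operations of the following kinds, in any order: exchange $(A_i,b_i)$ and $(A_j,b_j)$; replace $(A_i,b_i)$ by $\lambda(A_i,b_i)+\mu(A_j,b_j)$ with $\lambda,\mu\in\mathbb R$, $\lambda\ne0$ (where $j\neq i$, or $\mu=0$); replace all $A_i$ by $T^\top A_iT$ with $T$ invertible. A sequence $(M_1,\dots,M_k)$ of symmetric matrices is in *semidefinite echelon form with structure* $\{P_1,\dots,P_k\}$ if the $P_i$ are (possibly empty) pairwise disjoint subsets of $N$ and, for each $i$, the block $M_i(P_i,P_i)$ is diagonal with positive diagonal entries, the rows and columns of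 $M_i$ indexed by $P_1\cup\dots\cup P_{i-1}$ are arbitrary, and all remaining entries of $M_i$ are zero. The *base equations* for $(A_1,\dots,A_{k+1})$ and $(X_1,\dots,X_{\ell+1})$ are $$A_i\bullet X_j=\begin{cases}-1&\text{if }(i,j)=(k+1,\ell+1),\\0&\text{otherwise.}\end{cases}\tag{BASE}$$ **Algorithm 1.** (1) Choose $k,\ell\ge1$ and $m\ge k+1$, and choose $(A_1,\dots,A_{k+1})$ and $(X_1,\dots,X_{\ell+1})$ in semidefinite echelon form that satisfy (BASE). (2) Let $(b_1,\dots,b_{k+1})=(0,\dots,0,-1)$. (3) Choose symmetric $A_{k+2},\dots,A_m$ with $A_i\bullet X_j=0$ for $j=1,\dots,\ell$. (4) Set $b_i=A_i\bullet X_{\ell+1}$ for $i=k+2,\dots,m$. (5) Reformulate (P) and output the result. **Algorithm 2** (a subroutine for step (1), given $k,\ell\ge1$). Choose $(A_i)_{i=1}^{k+1}$ and $(X_j)_{j=1}^{\ell+1}$ in semidefinite echelon form with structures $\{P_i\}$ and $\{Q_j\}$ such that $P_1,\dots,P_k$ and $Q_1,\dots,Q_\ell$ are nonempty, $P_1\cap(Q_1\cup\dots\cup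 Q_{\ell+1})=\emptyset$ and $Q_1\cap(P_1\cup\dots\cup P_{k+1})=\emptyset$. Then, for $i=2,\dots,k+1$ in this order, reset the blocks $(P_{i-1},Q_1)$ of $A_i,X_2,\dots,X_{\ell+1}$, and symmetrically their blocks $(Q_1,P_{i-1})$, in any way such that the equations of (BASE) with left hand sides $A_i\bullet X_2,\dots,A_i\bullet X_{\ell+1}$ hold. **Theorem.** Every step of Algorithm 2 can be carried out, whatever the earlier choices were, and every completed run of Algorithm 2 yields $(A_1,\dots,A_{k+1})$ and $(X_1,\dots,X_{\ell+1})$ in semidefinite echelon form, with the structures chosen initially, that satisfy (BASE); from these, for every $m\ge k+1$, steps (2)–(4) of Algorithm 1 can be completed. Moreover, every output of Algorithm 1 is a weakly infeasible SDP, and every weakly infeasible SDP is among the possible outputs of Algorithm 1. Both statements hold when step (1) is carried out by an arbitrary choice as described there, and also when it is carried out by Algorithm 2. -/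

import Mathlib

open scoped Matrix

namespace WeakSDP

/-- Real `n × n` matrices. -/
abbrev Mat (n : ℕ) := Matrix (Fin n) (Fin n) ℝ

/-- The `•` product of symmetric matrices: the trace of their product. -/
noncomputable def bullet {n : ℕ} (A B : Mat n) : ℝ := (A * B).trace

/-- The Frobenius norm. -/
noncomputable def frobNorm {n : ℕ} (M : Mat n) : ℝ := Real.sqrt (Mᵀ * M).trace

/-- The data of a semidefinite feasibility problem
`A_i • X = b_i (i = 1, …, m), X ⪰ 0` with symmetric `n × n` matrices `A_i`. -/
structure SDP (n m : ℕ) where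
  A : Fin m → Mat n
  b : Fin m → ℝ
  symm : ∀ i, (A i).IsSymm

/-- The affine subspace `H` of the symmetric matrices that satisfy the equality constraints. -/
def SDP.affine {n m : ℕ} (S : SDP n m) : Set (Mat n) :=
  {X | X.IsSymm ∧ ∀ i, bullet (S.A i) X = S.b i}

/-- Some positive semidefinite matrix satisfies the equality constraints. -/
def SDP.Feasible {n m : ℕ} (S : SDP n m) : Prop :=
  ∃ X ∈ S.affine, X.PosSemidef

/-- There is no feasible solution, but `H` has distance zero to the positive semidefinite cone
(the distance from an empty `H` is infinite). -/
def SDP.WeaklyInfeasible {n m : ℕ} (S : SDP n m) : Prop :=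
  ¬ S.Feasible ∧
    ∀ ε : ℝ, 0 < ε → ∃ X ∈ S.affine, ∃ Y : Mat n, Y.PosSemidef ∧ frobNorm (X - Y) < ε

/-- One elementary reformulation operation. -/
inductive ReformStep {n m : ℕ} : SDP n m → SDP n m → Prop
  /-- Exchange two constraints. -/
  | exchange (S S' : SDP n m) (i j : Fin m) (hij : i ≠ j)
      (hA : S'.A = S.A ∘ Equiv.swap i j) (hb : S'.b = S.b ∘ Equiv.swap i j) :
      ReformStep S S'
  /-- Replace `(A_i, b_i)` by `c (A_i, b_i) + d (A_j, b_j)` with `c ≠ 0`; here `j` is another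
  index, except that a constraint may always be rescaled. -/
  | combine (S S' : SDP n m) (i j : Fin m) (c d : ℝ) (hc : c ≠ 0) (hij : i = j → d = 0)
      (hA : S'.A = Function.update S.A i (c • S.A i + d • S.A j))
      (hb : S'.b = Function.update S.b i (c * S.b i + d * S.b j)) :
      ReformStep S S'
  /-- Replace all `A_i` by `Tᵀ A_i T` with `T` invertible. -/
  | rotate (S S' : SDP n m) (T : Mat n) (hT : IsUnit T)
      (hA : ∀ i, S'.A i = Tᵀ * S.A i * T) (hb : S'.b = S.b) :
      ReformStep S S'

/-- `S'` is obtained from `S` by finitely many (possibly no) reformulation operations. -/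
def Reformulates {n m : ℕ} (S S' : SDP n m) : Prop :=
  Relation.ReflTransGen ReformStep S S'

/-- `(M_1, …, M_k)` is in semidefinite echelon form with structure `{P_1, …, P_k}`: all `M_i` are
symmetric, the `P_i` are pairwise disjoint, and outside the rows and columns indexed by
`P_1 ∪ … ∪ P_{i-1}` (where `M_i` is arbitrary) the only nonzero entries of `M_i` are positive
diagonal entries, in exactly the positions of `P_i`. -/
structure EchelonWith {n k : ℕ} (P : Fin k → Finset (Fin n)) (M : Fin k → Mat n) : Prop where
  symm : ∀ i, (M i).IsSymm
  disjoint : ∀ i j, i ≠ j → Disjoint (P i) (P j)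
  pos : ∀ i, ∀ a ∈ P i, 0 < M i a a
  zero : ∀ i a b, (∀ r < i, a ∉ P r ∧ b ∉ P r) → ¬ (a = b ∧ a ∈ P i) → M i a b = 0

/-- `(M_1, …, M_k)` is in semidefinite echelon form with some structure. -/
def Echelon {n k : ℕ} (M : Fin k → Mat n) : Prop :=
  ∃ P : Fin k → Finset (Fin n), EchelonWith P M

/-- The right hand sides of the base equations: `-1` if `(i, j) = (k+1, ℓ+1)`, and `0` otherwise. -/
noncomputable def baseRhs {k l : ℕ} (i : Fin (k + 1)) (j : Fin (l + 1)) : ℝ :=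
  if i = Fin.last k ∧ j = Fin.last l then -1 else 0

/-- The base equations for `(A_1, …, A_{k+1})` and `(X_1, …, X_{ℓ+1})`. -/
def BaseEquations {n k l : ℕ} (A : Fin (k + 1) → Mat n) (X : Fin (l + 1) → Mat n) : Prop :=
  ∀ i j, bullet (A i) (X j) = baseRhs i j

/-! ### The base equations algorithm -/

/-- The initial choice: `A` and `X` are in echelon form with structures `P` and `Q`, where
`P_1, …, P_k` and `Q_1, …, Q_ℓ` are nonempty, `P_1` is disjoint from all `Q_j`, and `Q_1` is
disjoint from all `P_i`. -/
structure InitialChoice {n k l : ℕ} (P : Fin (k + 1) → Finset (Fin n))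
    (Q : Fin (l + 1) → Finset (Fin n))
    (A : Fin (k + 1) → Mat n) (X : Fin (l + 1) → Mat n) : Prop where
  echelonA : EchelonWith P A
  echelonX : EchelonWith Q X
  nonemptyP : ∀ i : Fin k, (P i.castSucc).Nonempty
  nonemptyQ : ∀ j : Fin l, (Q j.castSucc).Nonempty
  disjointP : ∀ j, Disjoint (P 0) (Q j)
  disjointQ : ∀ i, Disjoint (Q 0) (P i)

/-- Pass `i` of the loop (`i = 2, …, k+1`, written here as `t.succ` with `t : Fin k`, so that
`P_{i-1}` is `P t.castSucc`). Only the blocks `(P_{i-1}, Q_1)` of `A_i, X_2, …, X_{ℓ+1}` and, by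
symmetry, the blocks `(Q_1, P_{i-1})` are changed; afterwards the base equations with left hand
sides `A_i • X_2, …, A_i • X_{ℓ+1}` hold. -/
structure LoopStep {n k l : ℕ} (P : Fin (k + 1) → Finset (Fin n))
    (Q : Fin (l + 1) → Finset (Fin n)) (t : Fin k)
    (A : Fin (k + 1) → Mat n) (X : Fin (l + 1) → Mat n)
    (A' : Fin (k + 1) → Mat n) (X' : Fin (l + 1) → Mat n) : Prop where
  otherA : ∀ i, i ≠ t.succ → A' i = A i
  firstX : X' 0 = X 0
  entriesA : ∀ a b, ¬ (a ∈ P t.castSucc ∧ b ∈ Q 0) → ¬ (a ∈ Q 0 ∧ b ∈ P t.castSucc) →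
    A' t.succ a b = A t.succ a b
  entriesX : ∀ a b, ¬ (a ∈ P t.castSucc ∧ b ∈ Q 0) → ¬ (a ∈ Q 0 ∧ b ∈ P t.castSucc) →
    ∀ j : Fin l, X' j.succ a b = X j.succ a b
  symmA : (A' t.succ).IsSymm
  symmX : ∀ j : Fin l, (X' j.succ).IsSymm
  equations : ∀ j : Fin l, bullet (A' t.succ) (X' j.succ) = baseRhs t.succ j.succ

/-- `LoopRun P Q s A X`: some run of the algorithm that starts from an initial choice with
structures `P` and `Q` holds the sequences `A` and `X` after the first `s` passes of the loop. -/
inductive LoopRun {n k l : ℕ} (P : Fin (k + 1) → Finset (Fin n))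
    (Q : Fin (l + 1) → Finset (Fin n)) :
    ℕ → (Fin (k + 1) → Mat n) → (Fin (l + 1) → Mat n) → Prop
  | init (A : Fin (k + 1) → Mat n) (X : Fin (l + 1) → Mat n)
      (h : InitialChoice P Q A X) : LoopRun P Q 0 A X
  | step (t : Fin k) (A : Fin (k + 1) → Mat n) (X : Fin (l + 1) → Mat n)
      (A' : Fin (k + 1) → Mat n) (X' : Fin (l + 1) → Mat n)
      (h : LoopRun P Q (t : ℕ) A X) (hs : LoopStep P Q t A X A' X') :
      LoopRun P Q ((t : ℕ) + 1) A' X'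

/-! ### The algorithm that constructs weakly infeasible SDPs -/

/-- A way to choose the sequences `(A_1, …, A_{k+1})` and `(X_1, …, X_{ℓ+1})`, given as the
relation of its possible results. -/
abbrev SequenceChoice (n : ℕ) :=
  ∀ k l : ℕ, (Fin (k + 1) → Mat n) → (Fin (l + 1) → Mat n) → Prop

/-- Choose any sequences in semidefinite echelon form that satisfy the base equations. -/
def anyChoice (n : ℕ) : SequenceChoice n := fun _ _ A X =>
  Echelon A ∧ Echelon X ∧ BaseEquations A X

/-- Choose sequences by a completed run of the base equations algorithm. -/
def loopChoice (n : ℕ) : SequenceChoice n := fun k _ A X =>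
  ∃ P Q, LoopRun P Q k A X

/-- The SDP `S` before the final reformulation: its first `k+1` constraint matrices are
`A_1, …, A_{k+1}`, with right hand sides `0, …, 0, -1`; each further constraint matrix is orthogonal
to `X_1, …, X_ℓ` and has its product with `X_{ℓ+1}` as right hand side. -/
structure Assembles {n m k l : ℕ} (hm : k + 1 ≤ m) (A : Fin (k + 1) → Mat n)
    (X : Fin (l + 1) → Mat n) (S : SDP n m) : Prop where
  headA : ∀ i : Fin (k + 1), S.A (Fin.castLE hm i) = A i
  headb : ∀ i : Fin (k + 1), S.b (Fin.castLE hm i) = if i = Fin.last k then -1 else 0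
  tailA : ∀ i : Fin m, k + 1 ≤ (i : ℕ) → ∀ j : Fin l, bullet (S.A i) (X j.castSucc) = 0
  tailb : ∀ i : Fin m, k + 1 ≤ (i : ℕ) → S.b i = bullet (S.A i) (X (Fin.last l))

/-- `S` is a possible output of the algorithm in which the echelon sequences are chosen by `C`. -/
def PossibleOutput {n m : ℕ} (C : SequenceChoice n) (S : SDP n m) : Prop :=
  ∃ k l : ℕ, 1 ≤ k ∧ 1 ≤ l ∧ ∃ hm : k + 1 ≤ m,
    ∃ (A : Fin (k + 1) → Mat n) (X : Fin (l + 1) → Mat n), C k l A X ∧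
      ∃ S₀ : SDP n m, Assembles hm A X S₀ ∧ Reformulates S₀ S

end WeakSDP

open scoped Matrix

namespace WeakSDP

variable {n m k l : ℕ}

/-! ### The trace product -/

/-! The sequence `A` certifies infeasibility, and `X` certifies distance zero. If `Y` is positive
semidefinite and satisfies the first `k+1` constraints, then `A_1 • Y = 0` kills the rows of `Y`
indexed by `P_1`, hence `A_2 • Y = 0` those of `P_2`, and so on, until the last equation equates a
nonnegative sum with `-1` (`Echelon.false_of_posSemidef`). Dually, `X_{ℓ+1} + ε I` is positive
definite on the vectors supported off `Q_1, …, Q_ℓ`. Adding suitable multiples of `X_ℓ, …, X_1`,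
which change no equation, extends this to all vectors (`Echelon.exists_add_posDef`). Reformulation
acts on solutions by invertible congruences, which preserve both properties.

Conversely, facial reduction (`exists_facial_reduction`) is run twice on a weakly infeasible SDP:
against the annihilator of its constraints because there is no solution, and against their span
because there is no certificate of strong infeasibility. This gives two sequences of forms, each
semidefinite on the radical left by its predecessors. The key point is that one basis, used for the
first sequence, and its dual basis, used for the second, put both into echelon form
(`exists_simultaneous_echelon`). The basis is built from pairs of singular vectors, chosen at the
deepest available levels of the two radical flags. Row operations then make the first sequence the
head of the constraints, and reversing all operations exhibits the SDP as an output.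

In the loop, every equation can be solved in one free entry, and later passes touch only entries
where the earlier `A_i` vanish (`LoopRun.invariant`). Base equations force the disjointness that the
loop demands (`disjoint_of_bullet_first`), so a run that changes nothing reaches every needed
choice. -/

theorem bullet_eq_sum (A B : Mat n) : bullet A B = ∑ a, ∑ b, A a b * B b a := by
  simp [bullet, Matrix.trace, Matrix.mul_apply]

theorem bullet_comm (A B : Mat n) : bullet A B = bullet B A := Matrix.trace_mul_comm A B

theorem bullet_add_left (A B C : Mat n) : bullet (A + B) C = bullet A C + bullet B C := by
  simp [bullet, add_mul]

theorem bullet_add_right (A B C : Mat n) : bullet A (B + C) = bullet A B + bullet A C := by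
  simp [bullet, mul_add]

theorem bullet_sub_right (A B C : Mat n) : bullet A (B - C) = bullet A B - bullet A C := by
  simp [bullet, mul_sub]

theorem bullet_smul_left (c : ℝ) (A B : Mat n) : bullet (c • A) B = c * bullet A B := by
  simp [bullet]

theorem bullet_smul_right (c : ℝ) (A B : Mat n) : bullet A (c • B) = c * bullet A B := by
  simp [bullet]

theorem bullet_zero_left (A : Mat n) : bullet 0 A = 0 := by simp [bullet]

theorem bullet_zero_right (A : Mat n) : bullet A 0 = 0 := by simp [bullet]

theorem bullet_transpose (A B : Mat n) : bullet Aᵀ B = bullet A Bᵀ := by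
  rw [bullet, bullet, ← Matrix.trace_transpose, Matrix.transpose_mul, Matrix.transpose_transpose,
    Matrix.trace_mul_comm]

theorem bullet_congruence (A X T S : Mat n) (h : T * S = 1) :
    bullet (Tᵀ * A * T) (S * X * Sᵀ) = bullet A X := by
  have h' : Sᵀ * Tᵀ = 1 := by rw [← Matrix.transpose_mul, h, Matrix.transpose_one]
  unfold bullet
  calc (Tᵀ * A * T * (S * X * Sᵀ)).trace = (Tᵀ * (A * (T * S) * X * Sᵀ)).trace := by
        simp only [Matrix.mul_assoc]
    _ = (A * X * (Sᵀ * Tᵀ)).trace := by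
        rw [Matrix.trace_mul_comm, h, Matrix.mul_one]; simp only [Matrix.mul_assoc]
    _ = (A * X).trace := by rw [h', Matrix.mul_one]

/-! ### The base equations algorithm -/

/-- Echelon form restricts only the entries outside the free rows and columns, and disjointness
places the diagonal positions of `P i` among them. So a loop pass, which edits only free entries, is
harmless. -/
theorem EchelonWith.of_eq {P : Fin k → Finset (Fin n)} {M M' : Fin k → Mat n}
    (h : EchelonWith P M) (hs : ∀ i, (M' i).IsSymm)
    (heq : ∀ i a b, (∀ r < i, a ∉ P r ∧ b ∉ P r) → M' i a b = M i a b) : EchelonWith P M' where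
  symm := hs
  disjoint := h.disjoint
  pos i a ha := by
    rw [heq i a a]
    · exact h.pos i a ha
    · intro r hr
      have := Finset.disjoint_right.1 (h.disjoint r i hr.ne) ha
      exact ⟨this, this⟩
  zero i a b hab hn := by rw [heq i a b hab]; exact h.zero i a b hab hn

theorem InitialChoice.bullet_first_left {P : Fin (k + 1) → Finset (Fin n)}
    {Q : Fin (l + 1) → Finset (Fin n)} {A : Fin (k + 1) → Mat n} {X : Fin (l + 1) → Mat n}
    (h : InitialChoice P Q A X) (j : Fin (l + 1)) : bullet (A 0) (X j) = 0 := by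
  rw [bullet_eq_sum]
  refine Finset.sum_eq_zero fun a _ => Finset.sum_eq_zero fun b _ => ?_
  by_cases hab : a = b ∧ a ∈ P 0
  · obtain ⟨rfl, ha⟩ := hab
    have hQ : ∀ r, a ∉ Q r := fun r => Finset.disjoint_left.1 (h.disjointP r) ha
    rw [h.echelonX.zero j a a (fun r _ => ⟨hQ r, hQ r⟩) (fun h' => hQ j h'.2), mul_zero]
  · rw [h.echelonA.zero 0 a b (fun r hr => absurd hr (Fin.not_lt_zero r)) hab, zero_mul]

theorem InitialChoice.swap {P : Fin (k + 1) → Finset (Fin n)}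
    {Q : Fin (l + 1) → Finset (Fin n)} {A : Fin (k + 1) → Mat n} {X : Fin (l + 1) → Mat n}
    (h : InitialChoice P Q A X) : InitialChoice Q P X A :=
  ⟨h.echelonX, h.echelonA, h.nonemptyQ, h.nonemptyP, h.disjointQ, h.disjointP⟩

theorem InitialChoice.bullet_first_right {P : Fin (k + 1) → Finset (Fin n)}
    {Q : Fin (l + 1) → Finset (Fin n)} {A : Fin (k + 1) → Mat n} {X : Fin (l + 1) → Mat n}
    (h : InitialChoice P Q A X) (i : Fin (k + 1)) : bullet (A i) (X 0) = 0 := by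
  rw [bullet_comm]; exact h.swap.bullet_first_left i

/-- The block that pass `t` edits in `X` is a zero block of every `A i` handled before: neither `P
t.castSucc` nor `Q 0` is free for such an `A i`, and the block misses the diagonal. -/
theorem InitialChoice.entry_eq_zero {P : Fin (k + 1) → Finset (Fin n)}
    {Q : Fin (l + 1) → Finset (Fin n)} {A : Fin (k + 1) → Mat n} {X : Fin (l + 1) → Mat n}
    (h : InitialChoice P Q A X) {t : Fin k} {i : Fin (k + 1)} (hi : i < t.succ) {a b : Fin n}
    (ha : a ∈ P t.castSucc) (hb : b ∈ Q 0) : A i a b = 0 := by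
  have hbP : ∀ r, b ∉ P r := fun r => Finset.disjoint_left.1 (h.disjointQ r) hb
  refine h.echelonA.zero i a b (fun r hr => ⟨?_, hbP r⟩) ?_
  · have hne : r ≠ t.castSucc := by
      rintro rfl
      have h1 := Fin.lt_def.1 hi
      have h2 := Fin.lt_def.1 hr
      simp at h1 h2
      omega
    exact Finset.disjoint_right.1 (h.echelonA.disjoint r _ hne) ha
  · rintro ⟨rfl, -⟩
    exact hbP _ ha

/-- A loop pass keeps the requirements of the initial choice. -/
theorem LoopStep.initialChoice {P : Fin (k + 1) → Finset (Fin n)}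
    {Q : Fin (l + 1) → Finset (Fin n)} {t : Fin k} {A A' : Fin (k + 1) → Mat n}
    {X X' : Fin (l + 1) → Mat n} (hs : LoopStep P Q t A X A' X') (h : InitialChoice P Q A X) :
    InitialChoice P Q A' X' where
  echelonA := by
    refine h.echelonA.of_eq (fun i => ?_) fun i a b hab => ?_
    · by_cases hi : i = t.succ
      · rw [hi]; exact hs.symmA
      · rw [hs.otherA i hi]; exact h.echelonA.symm i
    · by_cases hi : i = t.succ
      · subst hi
        have := hab t.castSucc Fin.castSucc_lt_succ
        exact hs.entriesA a b (fun h' => this.1 h'.1) (fun h' => this.2 h'.2)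
      · rw [hs.otherA i hi]
  echelonX := by
    refine h.echelonX.of_eq (fun j => ?_) fun j a b hab => ?_
    · induction j using Fin.cases with
      | zero => rw [hs.firstX]; exact h.echelonX.symm 0
      | succ j => exact hs.symmX j
    · induction j using Fin.cases with
      | zero => rw [hs.firstX]
      | succ j =>
        have := hab 0 (Fin.succ_pos j)
        exact hs.entriesX a b (fun h' => this.2 h'.2) (fun h' => this.1 h'.1) j
  nonemptyP := h.nonemptyP
  nonemptyQ := h.nonemptyQ
  disjointP := h.disjointP
  disjointQ := h.disjointQ

theorem baseRhs_zero_left (hk : 1 ≤ k) (j : Fin (l + 1)) : baseRhs (0 : Fin (k + 1)) j = 0 := by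
  unfold baseRhs
  rw [if_neg]
  rintro ⟨h, -⟩
  have := congrArg Fin.val h
  simp at this
  omega

theorem baseRhs_zero_right (hl : 1 ≤ l) (i : Fin (k + 1)) : baseRhs i (0 : Fin (l + 1)) = 0 := by
  unfold baseRhs
  rw [if_neg]
  rintro ⟨-, h⟩
  have := congrArg Fin.val h
  simp at this
  omega

/-- After `s` passes the rows `0, …, s` are settled; row `0` and column `0` hold automatically by
disjointness of the structures. -/
theorem LoopRun.invariant {P : Fin (k + 1) → Finset (Fin n)} {Q : Fin (l + 1) → Finset (Fin n)}
    (hk : 1 ≤ k) (hl : 1 ≤ l) {s : ℕ} {A : Fin (k + 1) → Mat n} {X : Fin (l + 1) → Mat n}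
    (h : LoopRun P Q s A X) :
    InitialChoice P Q A X ∧
      ∀ i : Fin (k + 1), (i : ℕ) ≤ s → ∀ j, bullet (A i) (X j) = baseRhs i j := by
  induction h with
  | init A X h =>
    refine ⟨h, fun i hi j => ?_⟩
    obtain rfl : i = 0 := Fin.ext (by simpa using hi)
    rw [h.bullet_first_left, baseRhs_zero_left hk]
  | step t A X A' X' _ hs ih =>
    obtain ⟨h, heq⟩ := ih
    have h' := hs.initialChoice h
    refine ⟨h', fun i hi j => ?_⟩
    induction j using Fin.cases with
    | zero => rw [h'.bullet_first_right, baseRhs_zero_right hl]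
    | succ j =>
      by_cases hit : i = t.succ
      · rw [hit]; exact hs.equations j
      · have hlt : i < t.succ := by
          rw [Fin.lt_def]
          have := fun e => hit (Fin.ext e)
          simp at this ⊢
          omega
        -- For a row settled earlier, the product is unchanged: the entries of `X` altered in this
        -- pass meet zeros of `A i`.
        rw [← heq i (by rw [Fin.lt_def] at hlt; simp at hlt; omega) j.succ, hs.otherA i hit,
          bullet_eq_sum, bullet_eq_sum]
        refine Finset.sum_congr rfl fun a _ => Finset.sum_congr rfl fun b _ => ?_
        by_cases h1 : b ∈ P t.castSucc ∧ a ∈ Q 0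
        · rw [← (h.echelonA.symm i).apply a b, h.entry_eq_zero hlt h1.1 h1.2, zero_mul, zero_mul]
        by_cases h2 : b ∈ Q 0 ∧ a ∈ P t.castSucc
        · rw [h.entry_eq_zero hlt h2.2 h2.1, zero_mul, zero_mul]
        rw [hs.entriesX b a h1 h2 j]

/-- One position `(p, q)` of the block suffices. Once that entry of the new `A_i` is normalised to
`1`, its product with the symmetric unit `E` is `2`, so each equation is solved separately by adding
a multiple of `E` to its own `X_j`. -/
theorem InitialChoice.exists_loopStep {P : Fin (k + 1) → Finset (Fin n)}
    {Q : Fin (l + 1) → Finset (Fin n)} {A : Fin (k + 1) → Mat n} {X : Fin (l + 1) → Mat n}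
    (h : InitialChoice P Q A X) (hl : 1 ≤ l) (t : Fin k) :
    ∃ A' X', LoopStep P Q t A X A' X' := by
  obtain ⟨p, hp⟩ := h.nonemptyP t
  obtain ⟨q, hq⟩ : (Q 0).Nonempty := h.nonemptyQ ⟨0, hl⟩
  have hpq : p ≠ q := fun e => Finset.disjoint_left.1 (h.disjointQ t.castSucc) hq (e ▸ hp)
  let E : Mat n := Matrix.single p q 1 + Matrix.single q p 1
  have hE : E.IsSymm := by
    simp [E, Matrix.IsSymm, Matrix.transpose_add, Matrix.transpose_single, add_comm]
  have hE0 : ∀ a b, ¬ (a ∈ P t.castSucc ∧ b ∈ Q 0) → ¬ (a ∈ Q 0 ∧ b ∈ P t.castSucc) →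
      E a b = 0 := by
    intro a b h1 h2
    have h3 : ¬ (p = a ∧ q = b) := by rintro ⟨rfl, rfl⟩; exact h1 ⟨hp, hq⟩
    have h4 : ¬ (q = a ∧ p = b) := by rintro ⟨rfl, rfl⟩; exact h2 ⟨hq, hp⟩
    simp [E, h3, h4]
  have hEpq : E p q = 1 := by simp [E, hpq, hpq.symm]
  have hbE : ∀ M : Mat n, M.IsSymm → bullet M E = 2 * M p q := by
    intro M hM
    have := hM.apply p q
    simp only [bullet, E, mul_add, Matrix.trace_add, Matrix.trace_mul_single]
    simp [this]
    ring
  let A₁ : Mat n := A t.succ + (1 - A t.succ p q) • E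
  have hA₁ : A₁.IsSymm := (h.echelonA.symm _).add (hE.smul _)
  have hb : bullet A₁ E = 2 := by rw [hbE A₁ hA₁]; simp [A₁, hEpq]
  let c : Fin l → ℝ := fun j => (baseRhs t.succ j.succ - bullet A₁ (X j.succ)) / 2
  refine ⟨Function.update A t.succ A₁, Fin.cases (X 0) fun j => X j.succ + c j • E,
    fun i hi => Function.update_of_ne hi _ _, rfl, fun a b h1 h2 => ?_, fun a b h1 h2 j => ?_,
    by simpa using hA₁, fun j => ?_, fun j => ?_⟩
  · simp [A₁, hE0 a b h1 h2]
  · simp [hE0 a b h1 h2]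
  · exact (h.echelonX.symm _).add (hE.smul _)
  · simp only [Function.update_self, Fin.cases_succ, bullet_add_right, bullet_smul_right, hb, c]
    ring

theorem exists_assembles (hm : k + 1 ≤ m) (A : Fin (k + 1) → Mat n) (X : Fin (l + 1) → Mat n)
    (hA : ∀ i, (A i).IsSymm) : ∃ S : SDP n m, Assembles hm A X S := by
  refine ⟨⟨fun i => if h : (i : ℕ) < k + 1 then A ⟨i, h⟩ else 0,
    fun i => if (i : ℕ) = k then -1 else 0, fun i => ?_⟩, ⟨fun i => ?_, fun i => ?_, ?_, ?_⟩⟩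
  · split_ifs
    · exact hA _
    · exact Matrix.isSymm_zero
  · exact dif_pos i.isLt
  · simp [Fin.ext_iff]
  · intro i hi j
    simp [not_lt.2 hi, bullet_zero_left]
  · intro i hi
    simp [not_lt.2 hi, bullet_zero_left, show (i : ℕ) ≠ k by omega]

/-! ### Quadratic forms -/

theorem dotProduct_mulVec_symm {A : Mat n} (hA : A.IsSymm) (x y : Fin n → ℝ) :
    x ⬝ᵥ A *ᵥ y = y ⬝ᵥ A *ᵥ x := by
  rw [Matrix.dotProduct_mulVec, ← Matrix.mulVec_transpose, hA.eq, dotProduct_comm]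

theorem bullet_vecMulVec (A : Mat n) (x y : Fin n → ℝ) :
    bullet A (Matrix.vecMulVec x y) = y ⬝ᵥ A *ᵥ x := by
  rw [bullet_comm, bullet, Matrix.trace_mul_comm, Matrix.mul_vecMulVec, Matrix.trace_vecMulVec,
    dotProduct_comm]

theorem continuous_quadratic (A : Mat n) : Continuous fun x : Fin n → ℝ => x ⬝ᵥ A *ᵥ x := by
  fun_prop

/-- If `D` is positive semidefinite on a subspace `U` and `M` is positive definite on the isotropic
vectors of `D` in `U`, then `M + c D` is positive definite on `U` for some `c`. -/
theorem exists_add_smul_pos (U : Submodule ℝ (Fin n → ℝ)) (M D : Mat n)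
    (hD : ∀ x ∈ U, 0 ≤ x ⬝ᵥ D *ᵥ x)
    (hM : ∀ x ∈ U, x ⬝ᵥ D *ᵥ x = 0 → x ≠ 0 → 0 < x ⬝ᵥ M *ᵥ x) :
    ∃ c : ℝ, ∀ x ∈ U, x ≠ 0 → 0 < x ⬝ᵥ (M + c • D) *ᵥ x := by
  by_contra! hcon
  have hexp : ∀ (c : ℝ) (x : Fin n → ℝ),
      x ⬝ᵥ (M + c • D) *ᵥ x = x ⬝ᵥ M *ᵥ x + c * (x ⬝ᵥ D *ᵥ x) := by
    intro c x
    rw [Matrix.add_mulVec, dotProduct_add, Matrix.smul_mulVec, dotProduct_smul, smul_eq_mul]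
  -- The unit vectors of `U` violating positivity for `c` form compact sets that shrink as `c`
  -- grows. If none were empty, a common point would be isotropic for `D`, contradicting `hM`.
  let K : ℕ → Set (Fin n → ℝ) := fun c =>
    (Metric.sphere 0 1 ∩ U) ∩ {x | x ⬝ᵥ (M + (c : ℝ) • D) *ᵥ x ≤ 0}
  have hUc : IsClosed (U : Set (Fin n → ℝ)) := U.closed_of_finiteDimensional
  have hclosed : ∀ c, IsClosed {x : Fin n → ℝ | x ⬝ᵥ (M + (c : ℝ) • D) *ᵥ x ≤ 0} := fun c =>
    isClosed_le (continuous_quadratic _) continuous_const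
  have hKc : ∀ c : ℕ, IsCompact (K c) := fun c =>
    ((isCompact_sphere 0 1).inter_right hUc).inter_right (hclosed c)
  have hne : ∀ c, (K c).Nonempty := by
    intro c
    obtain ⟨x, hxU, hx0, hx⟩ := hcon c
    have hn : ‖x‖ ≠ 0 := norm_ne_zero_iff.2 hx0
    refine ⟨‖x‖⁻¹ • x, ⟨?_, U.smul_mem _ hxU⟩, ?_⟩
    · simp [norm_smul, hn]
    · simp only [Set.mem_ofPred_eq, Matrix.mulVec_smul, dotProduct_smul, smul_dotProduct,
        smul_eq_mul]
      have : 0 ≤ ‖x‖⁻¹ := by positivity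
      exact mul_nonpos_of_nonneg_of_nonpos this (mul_nonpos_of_nonneg_of_nonpos this hx)
  obtain ⟨x, hx⟩ := IsCompact.nonempty_iInter_of_sequence_nonempty_isCompact_isClosed K
    (fun c x hx => by
      refine ⟨hx.1, ?_⟩
      have h1 := hx.2
      have h2 := hD x hx.1.2
      simp only [Set.mem_ofPred_eq, hexp] at h1 ⊢
      push_cast at h1
      linarith) hne (hKc 0) (fun c => (hKc c).isClosed)
  rw [Set.mem_iInter] at hx
  have hxU : x ∈ U := (hx 0).1.2
  have hx0 : x ≠ 0 := by
    rintro rfl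
    simpa using (hx 0).1.1
  have hle : ∀ c : ℕ, x ⬝ᵥ M *ᵥ x + c * (x ⬝ᵥ D *ᵥ x) ≤ 0 := fun c => by
    rw [← hexp]; exact (hx c).2
  have hD0 : x ⬝ᵥ D *ᵥ x = 0 := by
    by_contra hne
    have hpos := lt_of_le_of_ne (hD x hxU) (Ne.symm hne)
    obtain ⟨c, hc⟩ := exists_nat_gt (-(x ⬝ᵥ M *ᵥ x) / (x ⬝ᵥ D *ᵥ x))
    rw [div_lt_iff₀ hpos] at hc
    linarith [hle c]
  have := hM x hxU hD0 hx0
  have h0 := hle 0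
  simp at h0
  linarith

/-! ### Echelon forms -/

/-- The free rows and columns of `M i` meet zero rows and columns of `X`, so only the diagonal block
survives. -/
theorem EchelonWith.bullet_eq {P : Fin k → Finset (Fin n)} {M : Fin k → Mat n}
    (h : EchelonWith P M) (i : Fin k) {X : Mat n} (hX : X.IsSymm)
    (hX0 : ∀ r < i, ∀ a ∈ P r, ∀ b, X a b = 0) :
    bullet (M i) X = ∑ a ∈ P i, M i a a * X a a := by
  rw [bullet_eq_sum, ← Finset.sum_filter_add_sum_filter_not Finset.univ (· ∈ P i),
    Finset.filter_mem_eq_inter, Finset.univ_inter]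
  have hterm : ∀ a b, ¬ (a = b ∧ a ∈ P i) → M i a b * X b a = 0 := by
    intro a b hn
    by_cases hr : ∀ r < i, a ∉ P r ∧ b ∉ P r
    · rw [h.zero i a b hr hn, zero_mul]
    · push Not at hr
      obtain ⟨r, hri, hr⟩ := hr
      by_cases ha : a ∈ P r
      · rw [← hX.apply b a, hX0 r hri a ha, mul_zero]
      · rw [hX0 r hri b (hr ha), mul_zero]
  rw [add_eq_left.2]
  · refine Finset.sum_congr rfl fun a _ => ?_
    refine Finset.sum_eq_single a (fun b _ hb => hterm a b fun h' => hb h'.1.symm) ?_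
    simp
  · refine Finset.sum_eq_zero fun a ha => Finset.sum_eq_zero fun b _ => hterm a b fun h' => ?_
    exact (Finset.mem_filter.1 ha).2 h'.2

theorem EchelonWith.quadratic_eq {P : Fin k → Finset (Fin n)} {M : Fin k → Mat n}
    (h : EchelonWith P M) (i : Fin k) {x : Fin n → ℝ} (hx : ∀ r < i, ∀ a ∈ P r, x a = 0) :
    x ⬝ᵥ M i *ᵥ x = ∑ a ∈ P i, M i a a * x a ^ 2 := by
  rw [← bullet_vecMulVec, h.bullet_eq i]
  · exact Finset.sum_congr rfl fun a _ => by rw [Matrix.vecMulVec_apply, sq]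
  · exact Matrix.transpose_vecMulVec x x
  · intro r hr a ha b
    rw [Matrix.vecMulVec_apply, hx r hr a ha, zero_mul]

/-- Since `X a a = 0`, the form at `t e_a + e_b` is affine in `t`; being nonnegative for all `t`, it
has slope `2 X a b = 0`. -/
theorem posSemidef_row_eq_zero {X : Mat n} (hX : X.PosSemidef) {a : Fin n} (ha : X a a = 0)
    (b : Fin n) : X a b = 0 := by
  have h : ∀ t : ℝ, 0 ≤ 2 * t * X a b + X b b := by
    intro t
    have h1 := hX.dotProduct_mulVec_nonneg (t • Pi.single a 1 + Pi.single b 1)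
    have hs : X b a = X a b := by simpa using hX.1.apply a b
    have he : ∀ c d, (Pi.single c 1 : Fin n → ℝ) ⬝ᵥ X *ᵥ Pi.single d 1 = X c d := by
      intro c d
      simp
    simp only [star_trivial, Matrix.mulVec_add, Matrix.mulVec_smul, add_dotProduct, dotProduct_add,
      smul_dotProduct, dotProduct_smul, he, smul_eq_mul, ha, hs] at h1
    linarith
  by_contra hne
  have := h (-(X b b + 1) / (2 * X a b))
  have h2 : 2 * (-(X b b + 1) / (2 * X a b)) * X a b = -(X b b + 1) := by field_simp
  rw [h2] at this
  linarith

/-- An SDP whose constraints contain those of an echelon sequence with right hand sides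
`0, …, 0, -1` is infeasible. -/
theorem Echelon.false_of_posSemidef {A : Fin (k + 1) → Mat n} (hA : Echelon A) {X : Mat n}
    (hX : X.PosSemidef) (h : ∀ i, bullet (A i) X = if i = Fin.last k then -1 else 0) : False := by
  obtain ⟨P, hP⟩ := hA
  have hsymm : X.IsSymm := by simpa [Matrix.IsHermitian, Matrix.IsSymm] using hX.1
  have hnn : ∀ a, 0 ≤ X a a := fun a => hX.diag_nonneg
  -- The bound `r < k` leaves out the last equation, whose right hand side is `-1`.
  have key : ∀ s : ℕ, ∀ r : Fin (k + 1), (r : ℕ) < s → (r : ℕ) < k → ∀ a ∈ P r, ∀ b, X a b = 0 := by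
    intro s
    induction s with
    | zero => intro r hr; omega
    | succ s ih =>
      intro r hr hrk a ha b
      have hb := hP.bullet_eq r hsymm (fun r' hr' => ih r' (by rw [Fin.lt_def] at hr'; omega)
        (by rw [Fin.lt_def] at hr'; omega))
      rw [h r, if_neg (fun e => by simp [e] at hrk)] at hb
      have h0 := (Finset.sum_eq_zero_iff_of_nonneg
        (fun a ha => mul_nonneg (hP.pos r a ha).le (hnn a))).1 hb.symm a ha
      exact posSemidef_row_eq_zero hX
        ((mul_eq_zero.1 h0).resolve_left (hP.pos r a ha).ne') b
  have hb := hP.bullet_eq (Fin.last k) hsymm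
    (fun r hr => key k r (Fin.lt_def.1 hr) (Fin.lt_def.1 hr))
  rw [h, if_pos rfl] at hb
  have : 0 ≤ ∑ a ∈ P (Fin.last k), A (Fin.last k) a a * X a a :=
    Finset.sum_nonneg fun a ha => mul_nonneg (hP.pos _ a ha).le (hnn a)
  linarith

/-- An echelon sequence `(X_1, …, X_{ℓ+1})` yields matrices `X_{ℓ+1} + Σ c_j X_j` that are arbitrarily
close to the positive semidefinite cone. -/
theorem Echelon.exists_add_posDef {X : Fin (l + 1) → Mat n} (hX : Echelon X) {ε : ℝ} (hε : 0 < ε) :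
    ∃ Z ∈ Submodule.span ℝ (Set.range fun j : Fin l => X j.castSucc),
      ∀ x : Fin n → ℝ, x ≠ 0 → 0 < x ⬝ᵥ (X (Fin.last l) + Z + ε • (1 : Mat n)) *ᵥ x := by
  obtain ⟨Q, hQ⟩ := hX
  let U : ℕ → Submodule ℝ (Fin n → ℝ) := fun r =>
    { carrier := {x | ∀ s : Fin (l + 1), (s : ℕ) < r → ∀ a ∈ Q s, x a = 0}
      add_mem' := fun {x y} hx hy s hs a ha => by simp [hx s hs a ha, hy s hs a ha]
      zero_mem' := fun s _ a _ => rfl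
      smul_mem' := fun c x hx s hs a ha => by simp [hx s hs a ha] }
  have hquad : ∀ (r : Fin (l + 1)) (x : Fin n → ℝ), x ∈ U r →
      x ⬝ᵥ X r *ᵥ x = ∑ a ∈ Q r, X r a a * x a ^ 2 := fun r x hx =>
    hQ.quadratic_eq r fun s hs => hx s (Fin.lt_def.1 hs)
  have hnn : ∀ (r : Fin (l + 1)) (x : Fin n → ℝ), ∀ a ∈ Q r, 0 ≤ X r a a * x a ^ 2 :=
    fun r x a ha => mul_nonneg (hQ.pos r a ha).le (sq_nonneg _)
  -- Descending through the levels: `U (l - d)` consists of the vectors vanishing on the first `l -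
  -- d` sets `Q s`. The isotropic vectors of the next `X j` in the larger space are those of the
  -- smaller one, so `exists_add_smul_pos` enlarges the space.
  have key : ∀ d ≤ l, ∃ Z ∈ Submodule.span ℝ (Set.range fun j : Fin l => X j.castSucc),
      ∀ x ∈ U (l - d), x ≠ 0 → 0 < x ⬝ᵥ (X (Fin.last l) + Z + ε • (1 : Mat n)) *ᵥ x := by
    intro d
    induction d with
    | zero =>
      intro _
      refine ⟨0, Submodule.zero_mem _, fun x hx hx0 => ?_⟩
      rw [add_zero, Matrix.add_mulVec, dotProduct_add, Matrix.smul_mulVec, dotProduct_smul,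
        Matrix.one_mulVec, hquad (Fin.last l) x hx, smul_eq_mul]
      have h1 : 0 < x ⬝ᵥ x := by
        have := Matrix.dotProduct_star_self_pos_iff.2 hx0
        simpa using this
      exact add_pos_of_nonneg_of_pos (Finset.sum_nonneg (hnn _ x)) (mul_pos hε h1)
    | succ d ih =>
      intro hd
      obtain ⟨Z, hZ, hpos⟩ := ih (by omega)
      let j : Fin l := ⟨l - (d + 1), by omega⟩
      obtain ⟨c, hc⟩ := exists_add_smul_pos (U (l - (d + 1))) (X (Fin.last l) + Z + ε • (1 : Mat n))
        (X j.castSucc) (fun x hx => by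
          rw [hquad j.castSucc x hx]; exact Finset.sum_nonneg (hnn _ x))
        (fun x hx hx0 hne => by
          refine hpos x (fun s hs a ha => ?_) hne
          by_cases hlt : (s : ℕ) < l - (d + 1)
          · exact hx s hlt a ha
          · obtain rfl : s = j.castSucc := Fin.ext (by simp [j]; omega)
            rw [hquad j.castSucc x hx] at hx0
            have := (Finset.sum_eq_zero_iff_of_nonneg (hnn _ x)).1 hx0 a ha
            simpa [(hQ.pos _ a ha).ne'] using this)
      refine ⟨Z + c • X j.castSucc, Submodule.add_mem _ hZ
        (Submodule.smul_mem _ _ (Submodule.subset_span ⟨j, rfl⟩)), fun x hx hx0 => ?_⟩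
      have := hc x hx hx0
      rwa [show X (Fin.last l) + (Z + c • X j.castSucc) + ε • (1 : Mat n)
        = X (Fin.last l) + Z + ε • (1 : Mat n) + c • X j.castSucc by abel]
  obtain ⟨Z, hZ, hpos⟩ := key l le_rfl
  exact ⟨Z, hZ, fun x hx => hpos x (fun s hs => by omega) hx⟩

/-! ### The Frobenius norm -/

open scoped Matrix.Norms.Frobenius in
theorem frobNorm_eq_norm (M : Mat n) : frobNorm M = ‖M‖ := by
  rw [frobNorm, Matrix.frobenius_norm_def, Real.sqrt_eq_rpow]
  congr 1
  simp only [Matrix.trace, Matrix.diag, Matrix.mul_apply, Matrix.transpose_apply]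
  rw [Finset.sum_comm]
  simp [sq]

open scoped Matrix.Norms.Frobenius in
theorem frobNorm_congruence_le (R M : Mat n) :
    frobNorm (R * M * Rᵀ) ≤ frobNorm R * frobNorm Rᵀ * frobNorm M := by
  simp only [frobNorm_eq_norm]
  calc ‖R * M * Rᵀ‖ ≤ ‖R * M‖ * ‖Rᵀ‖ := Matrix.frobenius_norm_mul _ _
    _ ≤ ‖R‖ * ‖M‖ * ‖Rᵀ‖ := by gcongr; exact Matrix.frobenius_norm_mul _ _
    _ = ‖R‖ * ‖Rᵀ‖ * ‖M‖ := by ring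

open scoped Matrix.Norms.Frobenius in
theorem frobNorm_neg (M : Mat n) : frobNorm (-M) = frobNorm M := by
  simp only [frobNorm_eq_norm, norm_neg]

open scoped Matrix.Norms.Frobenius in
theorem frobNorm_smul (c : ℝ) (M : Mat n) : frobNorm (c • M) = |c| * frobNorm M := by
  simp only [frobNorm_eq_norm, norm_smul, Real.norm_eq_abs]

theorem frobNorm_nonneg (M : Mat n) : 0 ≤ frobNorm M := Real.sqrt_nonneg _

theorem abs_apply_le_frobNorm (M : Mat n) (a b : Fin n) : |M a b| ≤ frobNorm M := by
  refine Real.abs_le_sqrt ?_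
  simp only [Matrix.trace, Matrix.diag, Matrix.mul_apply, Matrix.transpose_apply]
  rw [sq]
  calc M a b * M a b ≤ ∑ c, M c b * M c b :=
        Finset.single_le_sum (f := fun c => M c b * M c b) (fun c _ => mul_self_nonneg _)
          (Finset.mem_univ a)
    _ ≤ _ := Finset.single_le_sum (f := fun d => ∑ c, M c d * M c d)
          (fun d _ => Finset.sum_nonneg fun c _ => mul_self_nonneg _) (Finset.mem_univ b)

theorem abs_bullet_le (A M : Mat n) : |bullet A M| ≤ (∑ a, ∑ b, |A a b|) * frobNorm M := by
  rw [bullet_eq_sum, Finset.sum_mul]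
  refine (Finset.abs_sum_le_sum_abs _ _).trans (Finset.sum_le_sum fun a _ => ?_)
  rw [Finset.sum_mul]
  refine (Finset.abs_sum_le_sum_abs _ _).trans (Finset.sum_le_sum fun b _ => ?_)
  rw [abs_mul]
  exact mul_le_mul_of_nonneg_left (abs_apply_le_frobNorm M b a) (abs_nonneg _)

/-! ### Reformulations -/

theorem ReformStep.symm {S S' : SDP n m} (h : ReformStep S S') : ReformStep S' S := by
  cases h with
  | exchange i j hij hA hb =>
    refine .exchange S' S i j hij ?_ ?_
    · rw [hA]; ext x; simp
    · rw [hb]; ext x; simp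
  | combine i j c d hc hij hA hb =>
    refine .combine S' S i j c⁻¹ (-(c⁻¹ * d)) (inv_ne_zero hc) (fun h => by simp [hij h]) ?_ ?_
    · rw [hA]
      by_cases h : i = j
      · subst h
        simp [hij rfl, smul_smul, inv_mul_cancel₀ hc]
      · rw [Function.update_self, Function.update_of_ne (Ne.symm h), smul_add, smul_smul,
          smul_smul, inv_mul_cancel₀ hc, Function.update_idem]
        simp
    · rw [hb]
      by_cases h : i = j
      · subst h
        simp [hij rfl, ← mul_assoc, inv_mul_cancel₀ hc]
      · rw [Function.update_self, Function.update_of_ne (Ne.symm h), mul_add, ← mul_assoc,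
          ← mul_assoc, inv_mul_cancel₀ hc, Function.update_idem]
        simp
  | rotate T hT hA hb =>
    have hdet : IsUnit T.det := (Matrix.isUnit_iff_isUnit_det T).1 hT
    refine .rotate S' S T⁻¹ (Matrix.isUnit_nonsing_inv_iff.2 hT) (fun i => ?_) hb.symm
    rw [hA]
    have h1 : T * T⁻¹ = 1 := Matrix.mul_nonsing_inv T hdet
    have h2 : T⁻¹ᵀ * Tᵀ = 1 := by rw [← Matrix.transpose_mul, h1, Matrix.transpose_one]
    calc S.A i = (T⁻¹ᵀ * Tᵀ) * S.A i * (T * T⁻¹) := by rw [h1, h2]; simp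
      _ = _ := by simp only [Matrix.mul_assoc]

theorem Reformulates.symm {S S' : SDP n m} (h : Reformulates S S') : Reformulates S' S := by
  induction h with
  | refl => exact .refl
  | tail _ hstep ih => exact .head hstep.symm ih

/-- Row operations leave `X` alone, and a rotation of the constraints by `T` is compensated by the
congruence with `T⁻¹`. One inclusion suffices because steps are reversible. -/
theorem ReformStep.exists_congruence {S S' : SDP n m} (h : ReformStep S S') :
    ∃ R : Mat n, ∀ X ∈ S.affine, R * X * Rᵀ ∈ S'.affine := by
  cases h with
  | exchange i j hij hA hb =>
    refine ⟨1, fun X hX => ⟨by simpa using hX.1, fun r => ?_⟩⟩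
    simpa [hA, hb] using hX.2 _
  | combine i j c d hc hij hA hb =>
    refine ⟨1, fun X hX => ⟨by simpa using hX.1, fun r => ?_⟩⟩
    rw [hA, hb]
    by_cases hr : r = i
    · subst hr
      simp [bullet_add_left, bullet_smul_left, hX.2]
    · simpa [hr] using hX.2 r
  | rotate T hT hA hb =>
    have hdet : IsUnit T.det := (Matrix.isUnit_iff_isUnit_det T).1 hT
    refine ⟨T⁻¹, fun X hX => ⟨?_, fun r => ?_⟩⟩
    · have := hX.1
      simp only [Matrix.IsSymm, Matrix.transpose_mul, Matrix.transpose_transpose] at this ⊢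
      rw [this, Matrix.mul_assoc]
    · rw [hA, hb, bullet_congruence _ _ _ _ (Matrix.mul_nonsing_inv T hdet), hX.2 r]

theorem posSemidef_congruence {X : Mat n} (hX : X.PosSemidef) (R : Mat n) :
    (R * X * Rᵀ).PosSemidef := by
  simpa using hX.mul_mul_conjTranspose_same R

/-- A congruence preserves semidefiniteness and stretches Frobenius distances by at most a fixed
factor. -/
theorem ReformStep.weaklyInfeasible {S S' : SDP n m} (h : ReformStep S S')
    (hS : S.WeaklyInfeasible) : S'.WeaklyInfeasible := by
  refine ⟨fun ⟨X, hX, hpos⟩ => ?_, fun ε hε => ?_⟩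
  · obtain ⟨R, hR⟩ := h.symm.exists_congruence
    exact hS.1 ⟨_, hR X hX, posSemidef_congruence hpos R⟩
  · obtain ⟨R, hR⟩ := h.exists_congruence
    set c := frobNorm R * frobNorm Rᵀ
    have hc : 0 ≤ c := mul_nonneg (frobNorm_nonneg _) (frobNorm_nonneg _)
    obtain ⟨X, hX, Y, hY, hXY⟩ := hS.2 (ε / (c + 1)) (by positivity)
    refine ⟨_, hR X hX, _, posSemidef_congruence hY R, ?_⟩
    rw [← Matrix.sub_mul, ← Matrix.mul_sub]
    refine (frobNorm_congruence_le R (X - Y)).trans_lt ?_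
    rw [lt_div_iff₀ (by positivity)] at hXY
    nlinarith [frobNorm_nonneg (X - Y)]

theorem Reformulates.weaklyInfeasible {S S' : SDP n m} (h : Reformulates S S')
    (hS : S.WeaklyInfeasible) : S'.WeaklyInfeasible := by
  induction h with
  | refl => exact hS
  | tail _ hstep ih => exact hstep.weaklyInfeasible ih

/-- `X_{ℓ+1}` satisfies all equations and still does after adding combinations `Z` of `X_1, …, X_ℓ`;
a small multiple of the identity then makes it semidefinite. -/
theorem Assembles.weaklyInfeasible {hm : k + 1 ≤ m} {A : Fin (k + 1) → Mat n}
    {X : Fin (l + 1) → Mat n} {S : SDP n m} (h : Assembles hm A X S) (hA : Echelon A)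
    (hX : Echelon X) (hbase : BaseEquations A X) : S.WeaklyInfeasible := by
  have hsymm : ∀ j, (X j).IsSymm := fun j => hX.choose_spec.symm j
  have hortho : ∀ (i : Fin m) (j : Fin l), bullet (S.A i) (X j.castSucc) = 0 := by
    intro i j
    by_cases hi : (i : ℕ) < k + 1
    · have := h.headA ⟨i, hi⟩
      rw [show Fin.castLE hm ⟨i, hi⟩ = i from rfl] at this
      rw [this, hbase, baseRhs, if_neg]
      rintro ⟨-, h'⟩
      exact (Fin.castSucc_lt_last j).ne h'
    · exact h.tailA i (by omega) j
  have hlast : ∀ i : Fin m, bullet (S.A i) (X (Fin.last l)) = S.b i := by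
    intro i
    by_cases hi : (i : ℕ) < k + 1
    · have h1 := h.headA ⟨i, hi⟩
      have h2 := h.headb ⟨i, hi⟩
      rw [show Fin.castLE hm ⟨i, hi⟩ = i from rfl] at h1 h2
      rw [h1, h2, hbase, baseRhs]
      simp
    · exact (h.tailb i (by omega)).symm
  refine ⟨fun ⟨Y, hY, hpos⟩ => hA.false_of_posSemidef hpos fun i => ?_, fun ε hε => ?_⟩
  · rw [← h.headA, hY.2, h.headb]
  · set c := frobNorm (1 : Mat n)
    have hc : 0 ≤ c := frobNorm_nonneg _
    -- The denominator is `c + 1` because the norm `c` of the identity is zero for `n = 0`.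
    obtain ⟨Z, hZ, hpos⟩ := hX.exists_add_posDef (ε := ε / (c + 1)) (by positivity)
    have hZ' : Z.IsSymm ∧ ∀ i, bullet (S.A i) Z = 0 := by
      clear hpos
      induction hZ using Submodule.span_induction with
      | mem Z hZ => obtain ⟨j, rfl⟩ := hZ; exact ⟨hsymm _, fun i => hortho i j⟩
      | zero => exact ⟨Matrix.isSymm_zero, fun i => bullet_zero_right _⟩
      | add Y Z _ _ hY hZ =>
        exact ⟨hY.1.add hZ.1, fun i => by rw [bullet_add_right, hY.2, hZ.2, add_zero]⟩
      | smul c Z _ hZ => exact ⟨hZ.1.smul c, fun i => by rw [bullet_smul_right, hZ.2, mul_zero]⟩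
    have hXZ : (X (Fin.last l) + Z).IsSymm := (hsymm _).add hZ'.1
    refine ⟨X (Fin.last l) + Z, ⟨hXZ, fun i => ?_⟩,
      X (Fin.last l) + Z + (ε / (c + 1)) • (1 : Mat n), ?_, ?_⟩
    · rw [bullet_add_right, hlast, hZ'.2, add_zero]
    · refine Matrix.PosSemidef.of_dotProduct_mulVec_nonneg ?_ fun x => ?_
      · have := hXZ.add (Matrix.isSymm_one.smul (ε / (c + 1)))
        simpa [Matrix.IsHermitian, Matrix.IsSymm] using this
      · by_cases hx : x = 0
        · simp [hx]
        · simpa using (hpos x hx).le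
    · rw [sub_add_cancel_left, frobNorm_neg, frobNorm_smul, abs_of_nonneg (by positivity),
        div_mul_eq_mul_div, div_lt_iff₀ (by positivity)]
      nlinarith

/-! ### Facial reduction -/

/-- A convex cone in a finite-dimensional space can be properly separated from any point outside. -/
theorem exists_proper_separation {E : Type*} [NormedAddCommGroup E] [NormedSpace ℝ E]
    [FiniteDimensional ℝ E] {C : Set E} (h0 : 0 ∈ C) (hadd : ∀ x ∈ C, ∀ y ∈ C, x + y ∈ C)
    (hsmul : ∀ c : ℝ, 0 ≤ c → ∀ x ∈ C, c • x ∈ C) {b : E} (hb : b ∉ C) :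
    ∃ f : E →ₗ[ℝ] ℝ, (∀ x ∈ C, 0 ≤ f x) ∧ f b ≤ 0 ∧ (f b < 0 ∨ ∃ x ∈ C, 0 < f x) := by
  -- Within its span the cone has interior, so Hahn–Banach gives a nonzero functional there. If `b`
  -- is outside the span, a functional vanishing on the cone separates strictly.
  by_cases hbR : b ∈ Submodule.span ℝ C
  · let R := Submodule.span ℝ C
    let C' : Set R := (↑) ⁻¹' C
    have hconv : Convex ℝ C' := by
      intro x hx y hy s t hs ht _
      exact hadd _ (hsmul s hs _ hx) _ (hsmul t ht _ hy)
    have hspan : Submodule.span ℝ C' = ⊤ := Submodule.span_span_coe_preimage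
    have hint : (interior C').Nonempty := by
      rw [hconv.interior_nonempty_iff_affineSpan_eq_top]
      have h := affineSpan_insert_zero (k := ℝ) C'
      rw [Set.insert_eq_of_mem (show (0 : R) ∈ C' from h0), hspan] at h
      exact SetLike.coe_injective h
    obtain ⟨g, hg0, hg⟩ := geometric_hahn_banach_of_nonempty_interior_point (x := (⟨b, hbR⟩ : R))
      hconv (fun h => hb (interior_subset h : (⟨b, hbR⟩ : R) ∈ C')) hint
    have hgb : 0 ≤ g ⟨b, hbR⟩ := by simpa using hg 0 h0
    have hgC : ∀ x ∈ C', g x ≤ 0 := by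
      intro x hx
      by_contra! hpos
      have := hg (((g ⟨b, hbR⟩ + 1) / g x) • x) (hsmul _ (by positivity) _ hx)
      rw [map_smul, smul_eq_mul, div_mul_cancel₀ _ hpos.ne'] at this
      linarith
    obtain ⟨f, hf⟩ := (-(g : R →ₗ[ℝ] ℝ)).exists_extend
    have hfg : ∀ x : R, f x = -g x := fun x => by
      have := LinearMap.congr_fun hf x
      simpa using this
    refine ⟨f, fun x hx => ?_, ?_, ?_⟩
    · have h1 := hfg ⟨x, Submodule.subset_span hx⟩
      have h2 := hgC ⟨x, Submodule.subset_span hx⟩ hx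
      simp only at h1
      linarith
    · have h1 := hfg ⟨b, hbR⟩
      simp only at h1
      linarith
    -- If `f` vanished on `C`, then `g` would vanish on a spanning set; this is where the separation
    -- is proper.
    · right
      by_contra! hcon
      refine hg0 (ContinuousLinearMap.coe_injective (LinearMap.ext_on hspan fun x hx => ?_))
      have h1 := hfg x
      have h2 := hcon x hx
      have h3 := hgC x hx
      simp only [ContinuousLinearMap.coe_coe, ContinuousLinearMap.toLinearMap_zero,
        LinearMap.zero_apply]
      linarith
  · obtain ⟨f, hfb, hf⟩ := Submodule.exists_dual_map_eq_bot_of_notMem hbR inferInstance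
    have hf0 : ∀ x ∈ C, f x = 0 := fun x hx => by
      have : f x ∈ (Submodule.span ℝ C).map f :=
        Submodule.mem_map_of_mem (Submodule.subset_span hx)
      rwa [hf, Submodule.mem_bot] at this
    rcases lt_or_gt_of_ne hfb with h | h
    · exact ⟨f, fun x hx => (hf0 x hx).ge, h.le, Or.inl h⟩
    · exact ⟨-f, fun x hx => by simp [hf0 x hx], by simpa using h.le, Or.inl (by simpa using h)⟩

theorem exists_bullet_eq (f : Mat n × ℝ →ₗ[ℝ] ℝ) :
    ∃ (G : Mat n) (β : ℝ), ∀ X t, f (X, t) = bullet G X + β * t := by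
  refine ⟨Matrix.of fun a b => f (Matrix.single b a 1, 0), f (0, 1), fun X t => ?_⟩
  have h1 : (X, t) = LinearMap.inl ℝ (Mat n) ℝ X + t • ((0 : Mat n), (1 : ℝ)) := by simp
  have h2 : ∀ a b, f (Matrix.single a b (X a b), 0) = X a b * f (Matrix.single a b 1, 0) := by
    intro a b
    rw [← smul_eq_mul, ← map_smul]
    simp
  rw [h1, map_add, map_smul, smul_eq_mul, mul_comm t]
  congr 1
  conv_lhs => rw [Matrix.matrix_eq_sum_single X]
  simp only [map_sum, LinearMap.inl_apply, h2, bullet_eq_sum, Matrix.of_apply]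
  rw [Finset.sum_comm]
  exact Finset.sum_congr rfl fun a _ => Finset.sum_congr rfl fun b _ => mul_comm _ _

/-! ### Radical flags and the theorem of the alternative -/

/-- The radical of the restriction to `U` of the bilinear form of `A`. -/
def formRadical (A : Mat n) (U : Submodule ℝ (Fin n → ℝ)) : Submodule ℝ (Fin n → ℝ) where
  carrier := {x | x ∈ U ∧ ∀ y ∈ U, y ⬝ᵥ A *ᵥ x = 0}
  add_mem' := fun {x y} hx hy => ⟨U.add_mem hx.1 hy.1, fun z hz => by
    rw [Matrix.mulVec_add, dotProduct_add, hx.2 z hz, hy.2 z hz, add_zero]⟩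
  zero_mem' := ⟨U.zero_mem, fun y _ => by simp⟩
  smul_mem' := fun c x hx => ⟨U.smul_mem c hx.1, fun z hz => by
    rw [Matrix.mulVec_smul, dotProduct_smul, hx.2 z hz, smul_zero]⟩

theorem formRadical_le (A : Mat n) (U : Submodule ℝ (Fin n → ℝ)) : formRadical A U ≤ U :=
  fun _ hx => hx.1

/-- The chain of subspaces that starts from `U` and in which each term is the radical of the next
form on the preceding term. -/
def radicalFlag (U : Submodule ℝ (Fin n → ℝ)) (A : ℕ → Mat n) : ℕ → Submodule ℝ (Fin n → ℝ)
  | 0 => U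
  | s + 1 => formRadical (A s) (radicalFlag U A s)

/-- Prepending a form shifts the flag by one level and starts it from the radical of that form, as
the induction in facial reduction requires. -/
theorem radicalFlag_cons (U : Submodule ℝ (Fin n → ℝ)) (G : Mat n) (A : ℕ → Mat n) (s : ℕ) :
    radicalFlag U (fun i => Nat.casesOn i G A) (s + 1) = radicalFlag (formRadical G U) A s := by
  induction s with
  | zero => rfl
  | succ s ih => rw [radicalFlag, ih, radicalFlag]

/-- The cone generated by the matrices `u uᵀ` with `u ∈ U`. -/
noncomputable def rankOneCone (U : Submodule ℝ (Fin n → ℝ)) : PointedCone ℝ (Mat n) :=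
  PointedCone.hull ℝ ((fun u => Matrix.vecMulVec u u) '' (U : Set (Fin n → ℝ)))

theorem rankOneCone_mono {U V : Submodule ℝ (Fin n → ℝ)} (h : U ≤ V) :
    rankOneCone U ≤ rankOneCone V :=
  Submodule.span_mono (Set.image_mono h)

theorem vecMulVec_mem_rankOneCone {U : Submodule ℝ (Fin n → ℝ)} {u : Fin n → ℝ} (hu : u ∈ U) :
    Matrix.vecMulVec u u ∈ rankOneCone U :=
  Submodule.subset_span ⟨u, hu, rfl⟩

theorem posSemidef_of_mem_rankOneCone {U : Submodule ℝ (Fin n → ℝ)} {X : Mat n}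
    (hX : X ∈ rankOneCone U) : X.PosSemidef := by
  induction hX using Submodule.span_induction with
  | mem X hX =>
    obtain ⟨u, -, rfl⟩ := hX
    simpa using Matrix.posSemidef_vecMulVec_self_star u
  | zero => exact Matrix.PosSemidef.zero
  | add X Y _ _ hX hY => exact hX.add hY
  | smul c X _ hX => exact hX.smul c.2

theorem bullet_nonneg_of_mem_rankOneCone {U : Submodule ℝ (Fin n → ℝ)} {G X : Mat n}
    (hG : ∀ u ∈ U, 0 ≤ u ⬝ᵥ G *ᵥ u) (hX : X ∈ rankOneCone U) : 0 ≤ bullet G X := by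
  induction hX using Submodule.span_induction with
  | mem X hX =>
    obtain ⟨u, hu, rfl⟩ := hX
    rw [bullet_vecMulVec]
    exact hG u hu
  | zero => rw [bullet_zero_right]
  | add X Y _ _ hX hY => rw [bullet_add_right]; exact add_nonneg hX hY
  | smul c X _ hX =>
    change 0 ≤ bullet G ((c : ℝ) • X)
    rw [bullet_smul_right]
    exact mul_nonneg c.2 hX

theorem quadratic_symmetrize (G : Mat n) (u : Fin n → ℝ) :
    u ⬝ᵥ ((1 / 2 : ℝ) • (G + Gᵀ)) *ᵥ u = u ⬝ᵥ G *ᵥ u := by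
  have : u ⬝ᵥ Gᵀ *ᵥ u = u ⬝ᵥ G *ᵥ u := by
    rw [Matrix.mulVec_transpose, dotProduct_comm, ← Matrix.dotProduct_mulVec]
  rw [Matrix.smul_mulVec, dotProduct_smul, Matrix.add_mulVec, dotProduct_add, this, smul_eq_mul]
  ring

/-- The theorem of the alternative behind one step of facial reduction. -/
theorem exists_reducing_matrix (𝓜 : Submodule ℝ (Mat n × ℝ))
    (htr : ∀ p ∈ 𝓜, (p.1ᵀ, p.2) ∈ 𝓜) (U : Submodule ℝ (Fin n → ℝ))
    (hU : ∀ X ∈ rankOneCone U, (X, (-1 : ℝ)) ∉ 𝓜) :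
    ∃ G : Mat n, G.IsSymm ∧ (∀ u ∈ U, 0 ≤ u ⬝ᵥ G *ᵥ u) ∧
      ((∀ p ∈ 𝓜, bullet G p.1 + -1 * p.2 = 0) ∨
        ((∀ p ∈ 𝓜, bullet G p.1 + 0 * p.2 = 0) ∧ formRadical G U < U)) := by
  classical
  let _ : NormedAddCommGroup (Mat n) := Matrix.frobeniusNormedAddCommGroup
  let _ : NormedSpace ℝ (Mat n) := Matrix.frobeniusNormedSpace
  -- `(0, 1) = (X, 0) + q` with `q ∈ 𝓜` would give `-q = (X, -1) ∈ 𝓜`, so the hypothesis says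
  -- exactly that `(0, 1)` lies outside `C`.
  let C : Set (Mat n × ℝ) := {p | ∃ X ∈ rankOneCone U, ∃ q ∈ 𝓜, p = (X, 0) + q}
  have hb : ((0 : Mat n), (1 : ℝ)) ∉ C := by
    rintro ⟨X, hX, ⟨Z, t⟩, hq, he⟩
    simp only [Prod.mk_add_mk, Prod.mk.injEq, zero_add] at he
    have := 𝓜.neg_mem hq
    rw [Prod.neg_mk, ← he.2, neg_eq_of_add_eq_zero_left he.1.symm] at this
    exact hU X hX this
  obtain ⟨f, hfC, hfb, hf⟩ := exists_proper_separation (C := C)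
    ⟨0, (rankOneCone U).zero_mem, 0, 𝓜.zero_mem, by rw [add_zero]; rfl⟩
    (by
      rintro _ ⟨X, hX, q, hq, rfl⟩ _ ⟨X', hX', q', hq', rfl⟩
      refine ⟨X + X', (rankOneCone U).add_mem hX hX', q + q', 𝓜.add_mem hq hq', ?_⟩
      rw [add_add_add_comm, Prod.mk_add_mk (a₁ := X), add_zero])
    (by
      rintro c hc _ ⟨X, hX, q, hq, rfl⟩
      refine ⟨c • X, ?_, c • q, 𝓜.smul_mem c hq, by simp⟩
      exact (rankOneCone U).smul_mem hc hX) hb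
  obtain ⟨G₀, β, hGβ⟩ := exists_bullet_eq f
  have hf𝓜 : ∀ p ∈ 𝓜, f p = 0 := by
    intro p hp
    have h1 := hfC p ⟨0, (rankOneCone U).zero_mem, p, hp, by simp⟩
    have h2 := hfC (-p) ⟨0, (rankOneCone U).zero_mem, -p, 𝓜.neg_mem hp, by simp⟩
    rw [map_neg] at h2
    linarith
  set G : Mat n := (1 / 2 : ℝ) • (G₀ + G₀ᵀ) with hG
  have hsymm : G.IsSymm := (Matrix.isSymm_add_transpose_self G₀).smul _
  have hpos : ∀ u ∈ U, 0 ≤ u ⬝ᵥ G *ᵥ u := by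
    intro u hu
    have := hfC (Matrix.vecMulVec u u, 0)
      ⟨_, vecMulVec_mem_rankOneCone hu, 0, 𝓜.zero_mem, by simp⟩
    rwa [hGβ, mul_zero, add_zero, bullet_vecMulVec, ← quadratic_symmetrize] at this
  have hann : ∀ p ∈ 𝓜, bullet G p.1 + β * p.2 = 0 := by
    intro p hp
    have h1 := hf𝓜 p hp
    have h2 := hf𝓜 _ (htr p hp)
    rw [show p = (p.1, p.2) from rfl, hGβ] at h1
    rw [hGβ] at h2
    rw [hG, bullet_smul_left, bullet_add_left, bullet_transpose]
    linarith
  have hβ : f (0, 1) = β := by rw [hGβ, bullet_zero_right]; ring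
  rw [hβ] at hfb hf
  -- For `β < 0`, scaling to `-1` yields the terminal matrix. For `β = 0`, proper separation
  -- provides a point of the cone on which `G` is positive, so `G` is not zero on `U` and the
  -- radical is smaller.
  rcases hfb.lt_or_eq with hneg | rfl
  · refine ⟨(-β)⁻¹ • G, hsymm.smul _, fun u hu => ?_, Or.inl fun p hp => ?_⟩
    · rw [Matrix.smul_mulVec, dotProduct_smul, smul_eq_mul]
      exact mul_nonneg (inv_nonneg.2 (by linarith)) (hpos u hu)
    · rw [bullet_smul_left, eq_neg_of_add_eq_zero_left (hann p hp)]
      field_simp [hneg.ne]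
      ring
  · refine ⟨G, hsymm, hpos, Or.inr ⟨hann, lt_of_le_of_ne (formRadical_le G U) fun heq => ?_⟩⟩
    obtain ⟨p, ⟨X, hX, q, hq, rfl⟩, hp⟩ := hf.resolve_left (lt_irrefl _)
    rw [map_add, hf𝓜 q hq, add_zero, hGβ, mul_zero, add_zero] at hp
    have h0 : 0 ≤ bullet (-G₀) X := by
      refine bullet_nonneg_of_mem_rankOneCone (fun u hu => ?_) hX
      have h1 : u ∈ formRadical G U := by rw [heq]; exact hu
      rw [Matrix.neg_mulVec, dotProduct_neg, ← quadratic_symmetrize, ← hG, h1.2 u hu, neg_zero]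
    rw [← neg_one_smul ℝ G₀, bullet_smul_left] at h0
    linarith

/-- **Facial reduction**: if no positive semidefinite matrix `X` built from `U` has `(X, -1) ∈ 𝓜`,
then there is a sequence of matrices certifying this. -/
theorem exists_facial_reduction (𝓜 : Submodule ℝ (Mat n × ℝ))
    (htr : ∀ p ∈ 𝓜, (p.1ᵀ, p.2) ∈ 𝓜) (U : Submodule ℝ (Fin n → ℝ))
    (hU : ∀ X ∈ rankOneCone U, (X, (-1 : ℝ)) ∉ 𝓜) :
    ∃ (k : ℕ) (A : ℕ → Mat n), (∀ i, i ≤ k → (A i).IsSymm) ∧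
      (∀ i, i ≤ k → ∀ u ∈ radicalFlag U A i, 0 ≤ u ⬝ᵥ A i *ᵥ u) ∧
      (∀ i, i ≤ k → ∀ p ∈ 𝓜, bullet (A i) p.1 + (if i = k then -1 else 0) * p.2 = 0) ∧
      ∀ i, i < k → radicalFlag U A (i + 1) < radicalFlag U A i := by
  -- Every nonterminal step lowers the dimension of `U`, so the process stops.
  induction hd : Module.finrank ℝ U using Nat.strong_induction_on generalizing U with
  | _ d ih =>
    obtain ⟨G, hsymm, hpos, hann | ⟨hann, hlt⟩⟩ := exists_reducing_matrix 𝓜 htr U hU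
    · exact ⟨0, fun _ => G, fun _ _ => hsymm, fun i hi => by
        obtain rfl : i = 0 := by omega
        exact hpos, fun i hi p hp => by simpa [show i = 0 by omega] using hann p hp,
        fun i hi => absurd hi (Nat.not_lt_zero i)⟩
    · obtain ⟨k, A, h1, h2, h3, h4⟩ := ih _ (hd ▸ Submodule.finrank_lt_finrank_of_lt hlt)
        (formRadical G U) (fun X hX => hU X (rankOneCone_mono hlt.le hX)) rfl
      refine ⟨k + 1, fun i => Nat.casesOn i G A, fun i hi => ?_, fun i hi => ?_,
        fun i hi p hp => ?_, fun i hi => ?_⟩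
      · cases i with
        | zero => exact hsymm
        | succ i => exact h1 i (by omega)
      · cases i with
        | zero => exact hpos
        | succ i => rw [radicalFlag_cons]; exact h2 i (by omega)
      · cases i with
        | zero => simpa using hann p hp
        | succ i => simpa using h3 i (by omega) p hp
      · cases i with
        | zero => exact hlt
        | succ i => rw [radicalFlag_cons, radicalFlag_cons]; exact h4 i (by omega)

/-! ### Simultaneous echelon bases -/

/-- Along `t e + y` the form is affine in `t` and nonnegative, so the mixed term vanishes. -/
theorem mem_formRadical_of_quadratic_eq_zero {G : Mat n} (hG : G.IsSymm)
    {U : Submodule ℝ (Fin n → ℝ)} (hpos : ∀ u ∈ U, 0 ≤ u ⬝ᵥ G *ᵥ u) {e : Fin n → ℝ} (he : e ∈ U)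
    (h0 : e ⬝ᵥ G *ᵥ e = 0) : e ∈ formRadical G U := by
  refine ⟨he, fun y hy => ?_⟩
  have h : ∀ t : ℝ, 0 ≤ 2 * t * (y ⬝ᵥ G *ᵥ e) + y ⬝ᵥ G *ᵥ y := by
    intro t
    have h1 := hpos _ (U.add_mem (U.smul_mem t he) hy)
    simp only [Matrix.mulVec_add, Matrix.mulVec_smul, add_dotProduct, dotProduct_add,
      smul_dotProduct, dotProduct_smul, smul_eq_mul, h0, dotProduct_mulVec_symm hG e y] at h1
    linarith
  by_contra hne
  have h1 := h (-(y ⬝ᵥ G *ᵥ y + 1) / (2 * (y ⬝ᵥ G *ᵥ e)))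
  have h2 : 2 * (-(y ⬝ᵥ G *ᵥ y + 1) / (2 * (y ⬝ᵥ G *ᵥ e))) * (y ⬝ᵥ G *ᵥ e)
      = -(y ⬝ᵥ G *ᵥ y + 1) := by field_simp
  rw [h2] at h1
  linarith

/-- The stationarity condition for one argument of a maximal pair. -/
theorem bilinear_eq_of_maximal {A : Mat n} (hA : A.IsSymm) {U : Submodule ℝ (Fin n → ℝ)}
    {e f : Fin n → ℝ} (he : e ∈ U) (hfe : f ⬝ᵥ e ≠ 0) {c : ℝ}
    (hle : ∀ x ∈ U, (f ⬝ᵥ x) ^ 2 ≤ c * (x ⬝ᵥ A *ᵥ x)) (heq : (f ⬝ᵥ e) ^ 2 = c * (e ⬝ᵥ A *ᵥ e))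
    {x : Fin n → ℝ} (hx : x ∈ U) :
    (f ⬝ᵥ e) * (x ⬝ᵥ A *ᵥ e) = (e ⬝ᵥ A *ᵥ e) * (f ⬝ᵥ x) := by
  have hexp : ∀ y z : Fin n → ℝ, y ⬝ᵥ (c • A - Matrix.vecMulVec f f) *ᵥ z
      = c * (y ⬝ᵥ A *ᵥ z) - (f ⬝ᵥ y) * (f ⬝ᵥ z) := by
    intro y z
    rw [Matrix.sub_mulVec, dotProduct_sub, Matrix.smul_mulVec, dotProduct_smul,
      Matrix.vecMulVec_mulVec, smul_eq_mul]
    simp [dotProduct_comm y f, mul_comm]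
  have hs : (c • A - Matrix.vecMulVec f f).IsSymm :=
    (hA.smul c).sub (Matrix.transpose_vecMulVec f f)
  -- By maximality the form of `c A - f fᵀ` is nonnegative on `U` and vanishes at `e`; membership of
  -- `e` in its radical replaces differentiation.
  have hrad := mem_formRadical_of_quadratic_eq_zero hs (U := U)
    (fun u hu => by rw [hexp]; nlinarith [hle u hu]) he (by rw [hexp]; nlinarith)
  have h := hrad.2 x hx
  rw [hexp] at h
  have h2 : (f ⬝ᵥ e) * ((f ⬝ᵥ e) * (x ⬝ᵥ A *ᵥ e)) = (f ⬝ᵥ e) * ((e ⬝ᵥ A *ᵥ e) * (f ⬝ᵥ x)) := by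
    calc _ = (f ⬝ᵥ e) ^ 2 * (x ⬝ᵥ A *ᵥ e) := by ring
      _ = (e ⬝ᵥ A *ᵥ e) * (c * (x ⬝ᵥ A *ᵥ e)) := by rw [heq]; ring
      _ = (e ⬝ᵥ A *ᵥ e) * ((f ⬝ᵥ x) * (f ⬝ᵥ e)) := by rw [sub_eq_zero.1 h]
      _ = _ := by ring
  exact mul_left_cancel₀ hfe h2

/-- Two subspaces with inner products that are not orthogonal to each other have a normalized pair
of singular vectors. -/
theorem exists_singular_pair_of_posDef {A X : Mat n} (hA : A.IsSymm) (hX : X.IsSymm)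
    {U C : Submodule ℝ (Fin n → ℝ)} (hU : ∀ x ∈ U, x ≠ 0 → 0 < x ⬝ᵥ A *ᵥ x)
    (hC : ∀ y ∈ C, y ≠ 0 → 0 < y ⬝ᵥ X *ᵥ y) (hne : ∃ x ∈ U, ∃ y ∈ C, y ⬝ᵥ x ≠ 0) :
    ∃ e ∈ U, ∃ f ∈ C, f ⬝ᵥ e = 1 ∧ (∀ x ∈ U, e ⬝ᵥ A *ᵥ x = (e ⬝ᵥ A *ᵥ e) * (f ⬝ᵥ x)) ∧
      ∀ y ∈ C, f ⬝ᵥ X *ᵥ y = (f ⬝ᵥ X *ᵥ f) * (y ⬝ᵥ e) := by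
  obtain ⟨x₀, hx₀, y₀, hy₀, hxy₀⟩ := hne
  have hx0 : x₀ ≠ 0 := by rintro rfl; simp at hxy₀
  have hy0 : y₀ ≠ 0 := by rintro rfl; simp at hxy₀
  let S : Submodule ℝ (Fin n → ℝ) → Set (Fin n → ℝ) := fun W => Metric.sphere 0 1 ∩ W
  have hS0 : ∀ W, ∀ x ∈ S W, x ≠ 0 := by
    rintro W x hx rfl
    simpa using hx.1
  have hSc : ∀ W, IsCompact (S W) := fun W =>
    (isCompact_sphere 0 1).inter_right W.closed_of_finiteDimensional
  have hScale : ∀ (W : Submodule ℝ (Fin n → ℝ)), ∀ x ∈ W, x ≠ 0 → ‖x‖⁻¹ • x ∈ S W := by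
    intro W x hx hx0
    refine ⟨?_, W.smul_mem _ hx⟩
    simp [norm_smul, norm_ne_zero_iff.2 hx0]
  -- The quotient is invariant under scaling of either vector, so its maximum over the unit spheres
  -- bounds it for all nonzero pairs.
  let φ : (Fin n → ℝ) × (Fin n → ℝ) → ℝ := fun z =>
    (z.2 ⬝ᵥ z.1) ^ 2 / ((z.1 ⬝ᵥ A *ᵥ z.1) * (z.2 ⬝ᵥ X *ᵥ z.2))
  have hφ : ContinuousOn φ (S U ×ˢ S C) := by
    refine ContinuousOn.div (by fun_prop) (by fun_prop) fun z hz => ?_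
    exact (mul_pos (hU _ hz.1.2 (hS0 U _ hz.1)) (hC _ hz.2.2 (hS0 C _ hz.2))).ne'
  obtain ⟨⟨e, f⟩, ⟨heS, hfS⟩, hmax⟩ := ((hSc U).prod (hSc C)).exists_isMaxOn
    ⟨(_, _), hScale U x₀ hx₀ hx0, hScale C y₀ hy₀ hy0⟩ hφ
  have heA := hU e heS.2 (hS0 U e heS)
  have hfX := hC f hfS.2 (hS0 C f hfS)
  set M := φ (e, f) with hM
  have hle : ∀ x ∈ U, ∀ y ∈ C, (y ⬝ᵥ x) ^ 2 ≤ M * ((x ⬝ᵥ A *ᵥ x) * (y ⬝ᵥ X *ᵥ y)) := by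
    intro x hx y hy
    by_cases hx0 : x = 0
    · simp [hx0]
    by_cases hy0 : y = 0
    · simp [hy0]
    have h1 : φ (‖x‖⁻¹ • x, ‖y‖⁻¹ • y) ≤ M := hmax ⟨hScale U x hx hx0, hScale C y hy hy0⟩
    have hxn : ‖x‖ ≠ 0 := norm_ne_zero_iff.2 hx0
    have hyn : ‖y‖ ≠ 0 := norm_ne_zero_iff.2 hy0
    have h2 : φ (‖x‖⁻¹ • x, ‖y‖⁻¹ • y) = (y ⬝ᵥ x) ^ 2 / ((x ⬝ᵥ A *ᵥ x) * (y ⬝ᵥ X *ᵥ y)) := by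
      simp only [φ, Matrix.mulVec_smul, smul_dotProduct, dotProduct_smul, smul_eq_mul]
      have := (hU x hx hx0).ne'
      have := (hC y hy hy0).ne'
      field_simp
    rwa [h2, div_le_iff₀ (mul_pos (hU x hx hx0) (hC y hy hy0))] at h1
  have heq : (f ⬝ᵥ e) ^ 2 = M * ((e ⬝ᵥ A *ᵥ e) * (f ⬝ᵥ X *ᵥ f)) :=
    (div_mul_cancel₀ _ (mul_pos heA hfX).ne').symm
  have hfe : f ⬝ᵥ e ≠ 0 := by
    intro h0
    rw [h0] at heq
    have hM0 : M = 0 := by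
      have := mul_pos heA hfX
      by_contra hM0
      exact (mul_ne_zero hM0 this.ne') (by linarith)
    have h1 := hle x₀ hx₀ y₀ hy₀
    rw [hM0, zero_mul] at h1
    exact hxy₀ (pow_eq_zero_iff two_ne_zero |>.1 (le_antisymm h1 (sq_nonneg _)))
  have hstatA := fun x hx => bilinear_eq_of_maximal hA heS.2 hfe (c := M * (f ⬝ᵥ X *ᵥ f))
    (fun x hx => by linarith [hle x hx f hfS.2]) (by rw [heq]; ring) (x := x) hx
  have hstatX := fun y hy => bilinear_eq_of_maximal hX hfS.2 (f := e)
    (by rwa [dotProduct_comm]) (c := M * (e ⬝ᵥ A *ᵥ e))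
    (fun y hy => by rw [dotProduct_comm]; linarith [hle e heS.2 y hy])
    (by rw [dotProduct_comm, heq]; ring) (x := y) hy
  refine ⟨e, heS.2, (f ⬝ᵥ e)⁻¹ • f, C.smul_mem _ hfS.2, ?_, fun x hx => ?_, fun y hy => ?_⟩
  · rw [smul_dotProduct, smul_eq_mul, inv_mul_cancel₀ hfe]
  · rw [dotProduct_mulVec_symm hA, smul_dotProduct, smul_eq_mul]
    have := hstatA x hx
    field_simp
    linarith
  · rw [dotProduct_mulVec_symm hX, Matrix.mulVec_smul, smul_dotProduct, dotProduct_smul,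
      dotProduct_smul, smul_eq_mul, smul_eq_mul, smul_eq_mul, dotProduct_comm y e]
    have := hstatX y hy
    rw [dotProduct_comm e f] at this
    field_simp
    linarith

/-- `X` may degenerate on `V`, but its radical there is orthogonal to `U`. A complement of the
radical carries the whole pairing and `X` is definite on it; the identity for `f` extends to `V`
since both sides vanish on the radical. -/
theorem exists_singular_pair {A X : Mat n} (hA : A.IsSymm) (hX : X.IsSymm)
    {U V : Submodule ℝ (Fin n → ℝ)} (hU : ∀ x ∈ U, x ≠ 0 → 0 < x ⬝ᵥ A *ᵥ x)
    (hV : ∀ y ∈ V, 0 ≤ y ⬝ᵥ X *ᵥ y) (hrad : ∀ y ∈ formRadical X V, ∀ x ∈ U, y ⬝ᵥ x = 0)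
    (hne : ∃ x ∈ U, ∃ y ∈ V, y ⬝ᵥ x ≠ 0) :
    ∃ e ∈ U, ∃ f ∈ V, f ⬝ᵥ e = 1 ∧ 0 < e ⬝ᵥ A *ᵥ e ∧ 0 < f ⬝ᵥ X *ᵥ f ∧
      (∀ x ∈ U, e ⬝ᵥ A *ᵥ x = (e ⬝ᵥ A *ᵥ e) * (f ⬝ᵥ x)) ∧
      ∀ y ∈ V, f ⬝ᵥ X *ᵥ y = (f ⬝ᵥ X *ᵥ f) * (y ⬝ᵥ e) := by
  obtain ⟨C₀, hC₀⟩ := exists_isCompl (formRadical X V)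
  have hdec : ∀ y ∈ V, ∃ r ∈ formRadical X V, ∃ c ∈ V ⊓ C₀, r + c = y := by
    intro y hy
    have hy' : y ∈ formRadical X V ⊔ C₀ := by rw [hC₀.sup_eq_top]; trivial
    obtain ⟨r, hr, c, hc, rfl⟩ := Submodule.mem_sup.1 hy'
    refine ⟨r, hr, c, ⟨?_, hc⟩, rfl⟩
    simpa using V.sub_mem hy hr.1
  have hC : ∀ y ∈ V ⊓ C₀, y ≠ 0 → 0 < y ⬝ᵥ X *ᵥ y := by
    intro y hy hy0
    refine lt_of_le_of_ne (hV y hy.1) fun h => hy0 ?_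
    have h1 := mem_formRadical_of_quadratic_eq_zero hX hV hy.1 h.symm
    have h2 : y ∈ formRadical X V ⊓ C₀ := ⟨h1, hy.2⟩
    rwa [hC₀.inf_eq_bot, Submodule.mem_bot] at h2
  obtain ⟨e, he, f, hf, hfe, h1, h2⟩ := exists_singular_pair_of_posDef hA hX hU hC (by
    obtain ⟨x, hx, y, hy, hxy⟩ := hne
    obtain ⟨r, hr, c, hc, rfl⟩ := hdec y hy
    refine ⟨x, hx, c, hc, ?_⟩
    rwa [add_dotProduct, hrad r hr x hx, zero_add] at hxy)
  refine ⟨e, he, f, hf.1, hfe, hU e he ?_, hC f hf ?_, h1, fun y hy => ?_⟩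
  · rintro rfl; simp at hfe
  · rintro rfl; simp at hfe
  · obtain ⟨r, hr, c, hc, rfl⟩ := hdec y hy
    rw [Matrix.mulVec_add, dotProduct_add, add_dotProduct, hr.2 f hf.1, hrad r hr e he, h2 c hc,
      zero_add, zero_add]

/-- The requirements on the `c`-th pair of a biorthogonal family of vectors, in terms of the
earlier pairs, that make it a simultaneous echelon basis. -/
structure EchelonPair (A X : ℕ → Mat n) (e f : ℕ → Fin n → ℝ) (p q : ℕ → ℕ) (c : ℕ) : Prop where
  memU : e c ∈ radicalFlag ⊤ A (p c)
  memV : f c ∈ radicalFlag ⊤ X (q c)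
  one : f c ⬝ᵥ e c = 1
  zero_left : ∀ d < c, f d ⬝ᵥ e c = 0
  zero_right : ∀ d < c, f c ⬝ᵥ e d = 0
  posA : 0 < e c ⬝ᵥ A (p c) *ᵥ e c
  posX : 0 < f c ⬝ᵥ X (q c) *ᵥ f c
  formA : ∀ x ∈ radicalFlag ⊤ A (p c), (∀ d < c, f d ⬝ᵥ x = 0) →
    e c ⬝ᵥ A (p c) *ᵥ x = (e c ⬝ᵥ A (p c) *ᵥ e c) * (f c ⬝ᵥ x)
  formX : ∀ y ∈ radicalFlag ⊤ X (q c), (∀ d < c, y ⬝ᵥ e d = 0) →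
    f c ⬝ᵥ X (q c) *ᵥ y = (f c ⬝ᵥ X (q c) *ᵥ f c) * (y ⬝ᵥ e c)

theorem EchelonPair.congr {A X : ℕ → Mat n} {e f e' f' : ℕ → Fin n → ℝ} {p q p' q' : ℕ → ℕ}
    {c : ℕ} (h : EchelonPair A X e f p q c) (he : ∀ d ≤ c, e' d = e d) (hf : ∀ d ≤ c, f' d = f d)
    (hp : p' c = p c) (hq : q' c = q c) : EchelonPair A X e' f' p' q' c where
  memU := by rw [he c le_rfl, hp]; exact h.memU
  memV := by rw [hf c le_rfl, hq]; exact h.memV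
  one := by rw [he c le_rfl, hf c le_rfl]; exact h.one
  zero_left d hd := by rw [he c le_rfl, hf d hd.le]; exact h.zero_left d hd
  zero_right d hd := by rw [hf c le_rfl, he d hd.le]; exact h.zero_right d hd
  posA := by rw [he c le_rfl, hp]; exact h.posA
  posX := by rw [hf c le_rfl, hq]; exact h.posX
  formA := by
    rw [he c le_rfl, hf c le_rfl, hp]
    exact fun x hx h0 => h.formA x hx fun d hd => by rw [← hf d hd.le]; exact h0 d hd
  formX := by
    rw [he c le_rfl, hf c le_rfl, hq]
    exact fun y hy h0 => h.formX y hy fun d hd => by rw [← he d hd.le]; exact h0 d hd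

theorem EchelonPair.biorthogonal {A X : ℕ → Mat n} {e f : ℕ → Fin n → ℝ} {p q : ℕ → ℕ} {r : ℕ}
    (h : ∀ c < r, EchelonPair A X e f p q c) {c d : ℕ} (hc : c < r) (hd : d < r) :
    f c ⬝ᵥ e d = if c = d then 1 else 0 := by
  rcases lt_trichotomy c d with hcd | rfl | hcd
  · rw [if_neg hcd.ne, (h d hd).zero_left c hcd]
  · rw [if_pos rfl, (h c hc).one]
  · rw [if_neg hcd.ne', (h c hc).zero_right d hcd]

/-- One more pair can be added to an incomplete biorthogonal family. -/
theorem exists_echelonPair {A X : ℕ → Mat n} (hA : ∀ s, (A s).IsSymm) (hX : ∀ s, (X s).IsSymm)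
    (hApos : ∀ s, ∀ u ∈ radicalFlag ⊤ A s, 0 ≤ u ⬝ᵥ A s *ᵥ u)
    (hXpos : ∀ s, ∀ u ∈ radicalFlag ⊤ X s, 0 ≤ u ⬝ᵥ X s *ᵥ u)
    (hAbot : ∃ s, radicalFlag ⊤ A s = ⊥) (hXbot : ∃ s, radicalFlag ⊤ X s = ⊥)
    {e f : ℕ → Fin n → ℝ} {p q : ℕ → ℕ} {r : ℕ} (hr : r < n)
    (h : ∀ c < r, EchelonPair A X e f p q c) :
    ∃ e' f' p' q', ∀ c < r + 1, EchelonPair A X e' f' p' q' c := by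
  classical
  -- Biorthogonality to the earlier pairs confines the new `e` to `E` and the new `f` to `F`.
  let E : Submodule ℝ (Fin n → ℝ) :=
    { carrier := {x | ∀ d < r, f d ⬝ᵥ x = 0}
      add_mem' := fun {x y} hx hy d hd => by rw [dotProduct_add, hx d hd, hy d hd, add_zero]
      zero_mem' := fun d _ => dotProduct_zero _
      smul_mem' := fun c x hx d hd => by rw [dotProduct_smul, hx d hd, smul_zero] }
  let F : Submodule ℝ (Fin n → ℝ) :=
    { carrier := {y | ∀ d < r, y ⬝ᵥ e d = 0}
      add_mem' := fun {x y} hx hy d hd => by rw [add_dotProduct, hx d hd, hy d hd, add_zero]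
      zero_mem' := fun d _ => zero_dotProduct _
      smul_mem' := fun c x hx d hd => by rw [smul_dotProduct, hx d hd, smul_zero] }
  have hE : E ≠ ⊥ := by
    let φ : (Fin n → ℝ) →ₗ[ℝ] (Fin r → ℝ) := Matrix.mulVecLin (Matrix.of fun d : Fin r => f d)
    have hφ : LinearMap.ker φ ≠ ⊥ := LinearMap.ker_ne_bot_of_finrank_lt (by simpa using hr)
    obtain ⟨x, hx, hx0⟩ := Submodule.exists_mem_ne_zero_of_ne_bot hφ
    refine Submodule.ne_bot_iff _ |>.2 ⟨x, fun d hd => ?_, hx0⟩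
    exact congrFun (LinearMap.mem_ker.1 hx) ⟨d, hd⟩
  -- Removing from `x` its components along the `f d` gives a vector of `F`, whose product with `x ∈
  -- E` is `x ⬝ᵥ x`.
  have hEF : ∀ x ∈ E, (∀ y ∈ F, y ⬝ᵥ x = 0) → x = 0 := by
    intro x hx hF
    have hy : x - ∑ d ∈ Finset.range r, (x ⬝ᵥ e d) • f d ∈ F := by
      intro c hc
      rw [sub_dotProduct, sum_dotProduct, Finset.sum_eq_single_of_mem c (Finset.mem_range.2 hc)]
      · rw [smul_dotProduct, (h c hc).one, smul_eq_mul, mul_one, sub_self]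
      · intro d hd hdc
        rw [smul_dotProduct, EchelonPair.biorthogonal h (Finset.mem_range.1 hd) hc, if_neg hdc,
          smul_zero]
    have h1 := hF _ hy
    rw [sub_dotProduct, sum_dotProduct, Finset.sum_eq_zero, sub_zero] at h1
    · exact dotProduct_self_eq_zero.1 h1
    · intro d hd
      rw [smul_dotProduct, hx d (Finset.mem_range.1 hd), smul_zero]
  have hexi : ∃ s, radicalFlag ⊤ A s ⊓ E = ⊥ := by
    obtain ⟨s, hs⟩ := hAbot
    exact ⟨s, by rw [hs, bot_inf_eq]⟩
  -- `i` is the deepest level at which the flag of `A` meets `E`, so `A i` is positive definite on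
  -- that intersection.
  obtain ⟨i, hi⟩ : ∃ i, Nat.find hexi = i + 1 := by
    refine Nat.exists_eq_succ_of_ne_zero fun h0 => hE ?_
    have := Nat.find_spec hexi
    rwa [h0, radicalFlag, top_inf_eq] at this
  have hi1 : radicalFlag ⊤ A (i + 1) ⊓ E = ⊥ := hi ▸ Nat.find_spec hexi
  have hi0 : radicalFlag ⊤ A i ⊓ E ≠ ⊥ := Nat.find_min hexi (by omega)
  have hexj : ∃ s, ∀ y ∈ radicalFlag ⊤ X s ⊓ F, ∀ x ∈ radicalFlag ⊤ A i ⊓ E, y ⬝ᵥ x = 0 := by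
    obtain ⟨s, hs⟩ := hXbot
    refine ⟨s, fun y hy x _ => ?_⟩
    rw [hs, bot_inf_eq, Submodule.mem_bot] at hy
    rw [hy, zero_dotProduct]
  -- `j` is the deepest level at which the flag of `X` within `F` is not orthogonal to that
  -- intersection; hence the radical of `X j` there is orthogonal to it.
  obtain ⟨j, hj⟩ : ∃ j, Nat.find hexj = j + 1 := by
    refine Nat.exists_eq_succ_of_ne_zero fun h0 => hi0 ?_
    have := Nat.find_spec hexj
    rw [h0, radicalFlag, top_inf_eq] at this
    refine (Submodule.eq_bot_iff _).2 fun x hx => hEF x hx.2 fun y hy => this y hy x hx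
  have hj1 : ∀ y ∈ radicalFlag ⊤ X (j + 1) ⊓ F, ∀ x ∈ radicalFlag ⊤ A i ⊓ E, y ⬝ᵥ x = 0 :=
    hj ▸ Nat.find_spec hexj
  have hj0 := Nat.find_min hexj (m := j) (by omega)
  push Not at hj0
  obtain ⟨y₀, hy₀, x₀, hx₀, hxy₀⟩ := hj0
  obtain ⟨e₁, he₁, f₁, hf₁, hfe, hpA, hpX, hfA, hfX⟩ := exists_singular_pair (hA i) (hX j)
    (U := radicalFlag ⊤ A i ⊓ E) (V := radicalFlag ⊤ X j ⊓ F)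
    (fun x hx hx0 => by
      refine lt_of_le_of_ne (hApos i x hx.1) fun h0 => hx0 ?_
      have h1 := mem_formRadical_of_quadratic_eq_zero (hA i) (hApos i) hx.1 h0.symm
      have h2 : x ∈ radicalFlag ⊤ A (i + 1) ⊓ E := ⟨h1, hx.2⟩
      rwa [hi1, Submodule.mem_bot] at h2)
    (fun y hy => hXpos j y hy.1)
    (fun y hy x hx => hj1 y ⟨mem_formRadical_of_quadratic_eq_zero (hX j) (hXpos j) hy.1.1
      (hy.2 y hy.1), hy.1.2⟩ x hx)
    ⟨x₀, hx₀, y₀, hy₀, hxy₀⟩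
  refine ⟨Function.update e r e₁, Function.update f r f₁, Function.update p r i,
    Function.update q r j, fun c hc => ?_⟩
  rcases (Nat.lt_succ_iff.1 hc).lt_or_eq with hc | rfl
  · exact (h c hc).congr (fun d hd => Function.update_of_ne (by omega) _ _)
      (fun d hd => Function.update_of_ne (by omega) _ _) (Function.update_of_ne (by omega) _ _)
      (Function.update_of_ne (by omega) _ _)
  · constructor <;> simp only [Function.update_self]
    · exact he₁.1
    · exact hf₁.1
    · exact hfe
    · intro d hd
      rw [Function.update_of_ne hd.ne]
      exact he₁.2 d hd
    · intro d hd
      rw [Function.update_of_ne hd.ne]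
      exact hf₁.2 d hd
    · exact hpA
    · exact hpX
    · exact fun x hx h0 => hfA x ⟨hx, fun d hd => by
        simpa only [Function.update_of_ne hd.ne] using h0 d hd⟩
    · exact fun y hy h0 => hfX y ⟨hy, fun d hd => by
        simpa only [Function.update_of_ne hd.ne] using h0 d hd⟩

theorem exists_echelonPairs {A X : ℕ → Mat n} (hA : ∀ s, (A s).IsSymm) (hX : ∀ s, (X s).IsSymm)
    (hApos : ∀ s, ∀ u ∈ radicalFlag ⊤ A s, 0 ≤ u ⬝ᵥ A s *ᵥ u)
    (hXpos : ∀ s, ∀ u ∈ radicalFlag ⊤ X s, 0 ≤ u ⬝ᵥ X s *ᵥ u)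
    (hAbot : ∃ s, radicalFlag ⊤ A s = ⊥) (hXbot : ∃ s, radicalFlag ⊤ X s = ⊥) :
    ∀ r ≤ n, ∃ e f p q, ∀ c < r, EchelonPair A X e f p q c := by
  intro r
  induction r with
  | zero => exact fun _ => ⟨0, 0, 0, 0, fun c hc => absurd hc (Nat.not_lt_zero c)⟩
  | succ r ih =>
    intro hr
    obtain ⟨e, f, p, q, h⟩ := ih (by omega)
    exact exists_echelonPair hA hX hApos hXpos hAbot hXbot (by omega) h

/-! ### From biorthogonal pairs to simultaneous echelon forms -/

theorem radicalFlag_antitone (U : Submodule ℝ (Fin n → ℝ)) (A : ℕ → Mat n) :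
    Antitone (radicalFlag U A) :=
  antitone_nat_of_succ_le fun _ => formRadical_le _ _

theorem radicalFlag_congr (U : Submodule ℝ (Fin n → ℝ)) {A B : ℕ → Mat n} {s : ℕ}
    (h : ∀ i < s, A i = B i) : radicalFlag U A s = radicalFlag U B s := by
  induction s with
  | zero => rfl
  | succ s ih => rw [radicalFlag, radicalFlag, ih fun i hi => h i (by omega), h s (by omega)]

theorem congruence_apply (A T : Mat n) (c d : Fin n) :
    (Tᵀ * A * T) c d = (fun a => T a c) ⬝ᵥ A *ᵥ (fun a => T a d) := by
  rw [Matrix.mul_assoc, Matrix.mul_apply]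
  rfl

/-- A basis, the columns of `T`, that is orthogonal for each form on the corresponding
quotient of the radical flag puts the sequence into echelon form. -/
theorem echelonWith_congruence {A : ℕ → Mat n} {T : Mat n} {p : Fin n → ℕ}
    (hA : ∀ s, (A s).IsSymm) (hmem : ∀ c, (fun a => T a c) ∈ radicalFlag ⊤ A (p c))
    (hpos : ∀ c, 0 < (Tᵀ * A (p c) * T) c c)
    (hortho : ∀ c d, c ≠ d → p c = p d → (Tᵀ * A (p c) * T) c d = 0) :
    EchelonWith (fun i : Fin k => Finset.univ.filter fun c => p c = i)
      (fun i => Tᵀ * A i * T) where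
  symm i := by
    have := hA i
    simp only [Matrix.IsSymm, Matrix.transpose_mul, Matrix.transpose_transpose] at this ⊢
    rw [this, Matrix.mul_assoc]
  disjoint i j hij := by
    rw [Finset.disjoint_left]
    intro c hc hc'
    simp only [Finset.mem_filter, Finset.mem_univ, true_and] at hc hc'
    exact hij (Fin.ext (hc.symm.trans hc'))
  pos i c hc := by
    simp only [Finset.mem_filter, Finset.mem_univ, true_and] at hc
    rw [← hc]
    exact hpos c
  zero i a b hab hn := by
    simp only [Finset.mem_filter, Finset.mem_univ, true_and] at hab hn
    have hai : (i : ℕ) ≤ p a := by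
      by_contra! hlt
      exact (hab ⟨p a, hlt.trans i.isLt⟩ (Fin.lt_def.2 hlt)).1 rfl
    have hbi : (i : ℕ) ≤ p b := by
      by_contra! hlt
      exact (hab ⟨p b, hlt.trans i.isLt⟩ (Fin.lt_def.2 hlt)).2 rfl
    have hmono := radicalFlag_antitone ⊤ A
    -- A vector of level above `i` lies in the radical of `A i` on the level-`i` space, which
    -- contains the other vector; two vectors of level exactly `i` fall to `hortho`.
    rcases hai.lt_or_eq with hlt | hae
    · rw [congruence_apply, dotProduct_mulVec_symm (hA i)]
      exact (hmono hlt (hmem a)).2 _ (hmono hbi (hmem b))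
    rcases hbi.lt_or_eq with hlt | hbe
    · rw [congruence_apply]
      exact (hmono hlt (hmem b)).2 _ (hmono hai (hmem a))
    have h0 := hortho a b (fun h => hn ⟨h, hae.symm⟩) (by omega)
    rwa [← hae] at h0

/-- Levels at which the radical flag drops occur as levels of basis vectors. -/
theorem exists_level_eq {A : ℕ → Mat n} {T S : Mat n} {p : Fin n → ℕ} (hTS : T * S = 1)
    (hmem : ∀ c, (fun a => T a c) ∈ radicalFlag ⊤ A (p c))
    (hpos : ∀ c, 0 < (Tᵀ * A (p c) * T) c c)
    (hortho : ∀ c d, c ≠ d → p c = p d → (Tᵀ * A (p c) * T) c d = 0) {s : ℕ}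
    (hlt : radicalFlag ⊤ A (s + 1) < radicalFlag ⊤ A s) : ∃ c, p c = s := by
  have hmono := radicalFlag_antitone ⊤ A
  have hexp : ∀ x : Fin n → ℝ, x = ∑ d, (S *ᵥ x) d • fun a => T a d := by
    intro x
    calc x = T *ᵥ (S *ᵥ x) := by rw [Matrix.mulVec_mulVec, hTS, Matrix.one_mulVec]
      _ = _ := by
        ext a
        simp [Matrix.mulVec, dotProduct, Finset.sum_apply, mul_comm]
  -- Vectors at level `s` of the flag have no coordinates of lower level: pairing with basis vector
  -- `c` under `A (p c)` isolates its coordinate. If no basis vector had level `s`, the flag could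
  -- not drop there.
  have hcoef : ∀ s x, x ∈ radicalFlag ⊤ A s → ∀ c, p c < s → (S *ᵥ x) c = 0 := by
    intro s
    induction s with
    | zero => intro x _ c hc; omega
    | succ s ih =>
      intro x hx c hc
      rcases (Nat.lt_succ_iff.1 hc).lt_or_eq with hc | rfl
      · exact ih x hx.1 c hc
      have h0 := hx.2 _ (hmem c)
      rw [hexp x, Matrix.mulVec_sum, dotProduct_sum, Finset.sum_eq_single c] at h0
      · rw [Matrix.mulVec_smul, dotProduct_smul, ← congruence_apply, smul_eq_mul] at h0
        exact (mul_eq_zero.1 h0).resolve_right (hpos c).ne'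
      · intro d _ hdc
        rw [Matrix.mulVec_smul, dotProduct_smul]
        rcases lt_trichotomy (p d) (p c) with h | h | h
        · rw [ih x hx.1 d h, zero_smul]
        · rw [← congruence_apply, hortho c d (Ne.symm hdc) h.symm, smul_zero]
        · rw [(hmono h (hmem d)).2 _ (hmem c), smul_zero]
      · exact fun h => absurd (Finset.mem_univ c) h
  by_contra! hne
  refine hlt.not_ge fun x hx => ?_
  rw [hexp x]
  refine Submodule.sum_mem _ fun c _ => ?_
  rcases lt_or_gt_of_ne (hne c) with h | h
  · rw [hcoef s x hx c h, zero_smul]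
    exact Submodule.zero_mem _
  · exact Submodule.smul_mem _ _ (hmono h (hmem c))

/-- Two reducing sequences, one for the forms on a space and one for the forms on its dual, can be
brought into echelon form by the same change of basis. -/
theorem exists_simultaneous_echelon {A X : ℕ → Mat n} (hA : ∀ i ≤ k, (A i).IsSymm)
    (hApos : ∀ i ≤ k, ∀ u ∈ radicalFlag ⊤ A i, 0 ≤ u ⬝ᵥ A i *ᵥ u)
    (hAlt : ∀ i < k, radicalFlag ⊤ A (i + 1) < radicalFlag ⊤ A i)
    (hX : ∀ j ≤ l, (X j).IsSymm)
    (hXpos : ∀ j ≤ l, ∀ u ∈ radicalFlag ⊤ X j, 0 ≤ u ⬝ᵥ X j *ᵥ u)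
    (hXlt : ∀ j < l, radicalFlag ⊤ X (j + 1) < radicalFlag ⊤ X j) :
    ∃ (T S : Mat n) (P : Fin (k + 1) → Finset (Fin n)) (Q : Fin (l + 1) → Finset (Fin n)),
      T * S = 1 ∧ EchelonWith P (fun i => Tᵀ * A i * T) ∧
      EchelonWith Q (fun j => S * X j * Sᵀ) ∧ (∀ i : Fin k, (P i.castSucc).Nonempty) ∧
      ∀ j : Fin l, (Q j.castSucc).Nonempty := by
  have hext : ∀ (k : ℕ) (A : ℕ → Mat n), (∀ i ≤ k, (A i).IsSymm) →
      (∀ i ≤ k, ∀ u ∈ radicalFlag ⊤ A i, 0 ≤ u ⬝ᵥ A i *ᵥ u) →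
      ∃ B : ℕ → Mat n, (∀ i ≤ k, B i = A i) ∧ (∀ i, (B i).IsSymm) ∧
        (∀ i, ∀ u ∈ radicalFlag ⊤ B i, 0 ≤ u ⬝ᵥ B i *ᵥ u) ∧ ∃ i, radicalFlag ⊤ B i = ⊥ := by
    intro k A hA hApos
    -- Padding with the identity forces the flag to `⊥` at level `k + 2` without changing levels up
    -- to `k`.
    let B : ℕ → Mat n := fun i => if i ≤ k then A i else 1
    have hB : ∀ i ≤ k, B i = A i := fun i hi => if_pos hi
    have hB1 : ∀ i, ¬ i ≤ k → B i = 1 := fun i hi => if_neg hi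
    refine ⟨B, hB, fun i => ?_, fun i u hu => ?_, k + 2, ?_⟩
    · by_cases hi : i ≤ k
      · rw [hB i hi]; exact hA i hi
      · rw [hB1 i hi]; exact Matrix.isSymm_one
    · by_cases hi : i ≤ k
      · rw [radicalFlag_congr ⊤ fun j hj => hB j (by omega)] at hu
        rw [hB i hi]
        exact hApos i hi u hu
      · rw [hB1 i hi, Matrix.one_mulVec]
        exact Finset.sum_nonneg fun a _ => mul_self_nonneg _
    · rw [Submodule.eq_bot_iff]
      intro x hx
      have := hx.2 x hx.1
      rw [hB1 _ (by omega), Matrix.one_mulVec] at this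
      exact dotProduct_self_eq_zero.1 this
  obtain ⟨A', hAA', hA', hApos', hAbot⟩ := hext k A hA hApos
  obtain ⟨X', hXX', hX', hXpos', hXbot⟩ := hext l X hX hXpos
  obtain ⟨e, f, p, q, h⟩ := exists_echelonPairs hA' hX' hApos' hXpos' hAbot hXbot n le_rfl
  let T : Mat n := Matrix.of fun a c => e c a
  let S : Mat n := Matrix.of fun c a => f c a
  have hST : S * T = 1 := by
    ext c d
    rw [Matrix.mul_apply, Matrix.one_apply]
    refine (EchelonPair.biorthogonal h c.isLt d.isLt).trans ?_
    simp [Fin.ext_iff]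
  have hTS : T * S = 1 := mul_eq_one_comm.1 hST
  have hSTt : Sᵀ * Tᵀ = 1 := by rw [← Matrix.transpose_mul, hTS, Matrix.transpose_one]
  have hmemT : ∀ c : Fin n, (fun a => T a c) ∈ radicalFlag ⊤ A' (p c) := fun c => (h c c.isLt).memU
  have hposT : ∀ c : Fin n, 0 < (Tᵀ * A' (p c) * T) c c := fun c => by
    rw [congruence_apply]; exact (h c c.isLt).posA
  have hmemS : ∀ c : Fin n, (fun a => Sᵀ a c) ∈ radicalFlag ⊤ X' (q c) :=
    fun c => (h c c.isLt).memV
  have hposS : ∀ c : Fin n, 0 < (Sᵀᵀ * X' (q c) * Sᵀ) c c := fun c => by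
    rw [congruence_apply]; exact (h c c.isLt).posX
  -- `formA` for `c` covers the vectors orthogonal to all earlier `f`, hence every later `e d`; the
  -- other order follows by symmetry.
  have hltT : ∀ c d : Fin n, c < d → p c = p d → e c ⬝ᵥ A' (p c) *ᵥ e d = 0 := by
    intro c d hcd hp
    rw [(h c c.isLt).formA _ (hp ▸ (h d d.isLt).memU)
      fun d' hd' => (h d d.isLt).zero_left d' (hd'.trans hcd),
      (h d d.isLt).zero_left c hcd, mul_zero]
  have hltS : ∀ c d : Fin n, c < d → q c = q d → f c ⬝ᵥ X' (q c) *ᵥ f d = 0 := by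
    intro c d hcd hq
    rw [(h c c.isLt).formX _ (hq ▸ (h d d.isLt).memV)
      fun d' hd' => (h d d.isLt).zero_right d' (hd'.trans hcd),
      (h d d.isLt).zero_right c hcd, mul_zero]
  have horthoT : ∀ c d : Fin n, c ≠ d → p c = p d → (Tᵀ * A' (p c) * T) c d = 0 := by
    intro c d hcd hp
    rw [congruence_apply]
    rcases lt_or_gt_of_ne hcd with hlt | hlt
    · exact hltT c d hlt hp
    · rw [dotProduct_mulVec_symm (hA' _), hp]
      exact hltT d c hlt hp.symm
  have horthoS : ∀ c d : Fin n, c ≠ d → q c = q d → (Sᵀᵀ * X' (q c) * Sᵀ) c d = 0 := by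
    intro c d hcd hq
    rw [congruence_apply]
    rcases lt_or_gt_of_ne hcd with hlt | hlt
    · exact hltS c d hlt hq
    · rw [dotProduct_mulVec_symm (hX' _), hq]
      exact hltS d c hlt hq.symm
  refine ⟨T, S, fun i => Finset.univ.filter fun c : Fin n => p c = i,
    fun j => Finset.univ.filter fun c : Fin n => q c = j, hTS, ?_, ?_, fun i => ?_, fun j => ?_⟩
  · have := echelonWith_congruence (k := k + 1) hA' hmemT hposT horthoT
    rwa [show (fun i : Fin (k + 1) => Tᵀ * A' i * T) = fun i : Fin (k + 1) => Tᵀ * A i * T from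
      funext fun i => by rw [hAA' i (by omega)]] at this
  · have := echelonWith_congruence (k := l + 1) hX' hmemS hposS horthoS
    rwa [show (fun j : Fin (l + 1) => Sᵀᵀ * X' j * Sᵀ) = fun j : Fin (l + 1) => S * X j * Sᵀ from
      funext fun j => by rw [hXX' j (by omega), Matrix.transpose_transpose]] at this
  · obtain ⟨c, hc⟩ := exists_level_eq hTS hmemT hposT horthoT (s := i) (by
      rw [radicalFlag_congr ⊤ fun j hj => hAA' j (by omega),
        radicalFlag_congr ⊤ (s := i) fun j hj => hAA' j (by omega)]
      exact hAlt i i.isLt)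
    exact ⟨c, by simpa using hc⟩
  · obtain ⟨c, hc⟩ := exists_level_eq hSTt hmemS hposS horthoS (s := j) (by
      rw [radicalFlag_congr ⊤ fun i hi => hXX' i (by omega),
        radicalFlag_congr ⊤ (s := j) fun i hi => hXX' i (by omega)]
      exact hXlt j j.isLt)
    exact ⟨c, by simpa using hc⟩

/-! ### Row operations -/

/-- The `i`-th constraint of an SDP. -/
def SDP.row (S : SDP n m) (i : Fin m) : Mat n × ℝ := (S.A i, S.b i)

/-- The linear span of the constraints. -/
def SDP.rowSpan (S : SDP n m) : Submodule ℝ (Mat n × ℝ) := Submodule.span ℝ (Set.range S.row)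

theorem SDP.row_mem_rowSpan (S : SDP n m) (i : Fin m) : S.row i ∈ S.rowSpan :=
  Submodule.subset_span ⟨i, rfl⟩

theorem exists_combine (S : SDP n m) (i j : Fin m) (c d : ℝ) (hc : c ≠ 0) (hij : i = j → d = 0) :
    ∃ S' : SDP n m, ReformStep S S' ∧
      S'.row = Function.update S.row i (c • S.row i + d • S.row j) := by
  let S' : SDP n m := ⟨Function.update S.A i (c • S.A i + d • S.A j),
    Function.update S.b i (c * S.b i + d * S.b j), fun r => by
      by_cases hr : r = i
      · subst hr
        simpa using ((S.symm r).smul c).add ((S.symm j).smul d)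
      · simpa [hr] using S.symm r⟩
  refine ⟨S', .combine S S' i j c d hc hij rfl rfl, ?_⟩
  ext1 r
  by_cases hr : r = i
  · subst hr
    simp [SDP.row, S']
  · simp [SDP.row, S', hr]

theorem exists_exchange (S : SDP n m) (i j : Fin m) :
    ∃ S' : SDP n m, Reformulates S S' ∧ S'.row = S.row ∘ Equiv.swap i j := by
  by_cases hij : i = j
  · subst hij
    exact ⟨S, .refl, by simp⟩
  · exact ⟨⟨S.A ∘ Equiv.swap i j, S.b ∘ Equiv.swap i j, fun r => S.symm _⟩,
      .single (.exchange _ _ i j hij rfl rfl), rfl⟩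

/-- Row `i` is rescaled by `c i ≠ 0`, then the other rows, which stay unchanged, are added one at a
time. -/
theorem exists_linear_combination (S : SDP n m) (i : Fin m) (c : Fin m → ℝ) (hc : c i ≠ 0) :
    ∃ S' : SDP n m, Reformulates S S' ∧
      S'.row = Function.update S.row i (∑ j, c j • S.row j) := by
  classical
  have key : ∀ s : Finset (Fin m), i ∉ s → ∃ S' : SDP n m, Reformulates S S' ∧
      S'.row = Function.update S.row i (c i • S.row i + ∑ j ∈ s, c j • S.row j) := by
    intro s
    induction s using Finset.induction_on with
    | empty =>
      intro _
      obtain ⟨S', h, hrow⟩ := exists_combine S i i (c i) 0 hc fun _ => rfl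
      exact ⟨S', .single h, by simpa using hrow⟩
    | insert j s hj ih =>
      intro hi
      rw [Finset.mem_insert, not_or] at hi
      obtain ⟨S₁, h₁, hrow₁⟩ := ih hi.2
      obtain ⟨S₂, h₂, hrow₂⟩ := exists_combine S₁ i j 1 (c j) one_ne_zero fun h => absurd h hi.1
      refine ⟨S₂, h₁.tail h₂, ?_⟩
      rw [hrow₂, hrow₁, Function.update_idem, Function.update_self,
        Function.update_of_ne (Ne.symm hi.1), Finset.sum_insert hj, one_smul, add_assoc,
        add_comm (c j • _)]
  obtain ⟨S', h, hrow⟩ := key (Finset.univ.erase i) (Finset.notMem_erase i _)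
  refine ⟨S', h, ?_⟩
  rw [hrow, Finset.add_sum_erase _ (fun j => c j • S.row j) (Finset.mem_univ i)]

/-- A sequence in the span of the constraints that is triangular with respect to some linear
functionals can be made the head of the constraints by row operations. -/
theorem exists_row_reformulation (S : SDP n m) (v : ℕ → Mat n × ℝ)
    (φ : ℕ → Mat n × ℝ →ₗ[ℝ] ℝ) (r : ℕ) (hv : ∀ i < r, v i ∈ S.rowSpan)
    (hφ : ∀ i < r, φ i (v i) ≠ 0) (hφ0 : ∀ i < r, ∀ j < i, φ i (v j) = 0) :
    r ≤ m ∧ ∃ S' : SDP n m, Reformulates S S' ∧ S'.rowSpan = S.rowSpan ∧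
      ∀ i : Fin m, (i : ℕ) < r → S'.row i = v i := by
  induction r with
  | zero => exact ⟨Nat.zero_le m, S, .refl, rfl, fun i hi => absurd hi (Nat.not_lt_zero _)⟩
  | succ r ih =>
    obtain ⟨-, S₁, h₁, hspan₁, hrow₁⟩ := ih (fun i hi => hv i (by omega))
      (fun i hi => hφ i (by omega)) fun i hi => hφ0 i (by omega)
    have hvr := hv r (by omega)
    rw [← hspan₁, SDP.rowSpan, Submodule.mem_span_range_iff_exists_fun] at hvr
    obtain ⟨c, hc⟩ := hvr
    -- `φ r` kills the first `r` rows but not `v r`, so expanding `v r` must use a row beyond the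
    -- head. That row is replaced by `v r` and swapped into position `r`.
    obtain ⟨j, hcj, hjr⟩ : ∃ j, c j ≠ 0 ∧ r ≤ (j : ℕ) := by
      by_contra! hcon
      refine hφ r (by omega) ?_
      rw [← hc, map_sum]
      refine Finset.sum_eq_zero fun j _ => ?_
      rw [map_smul]
      by_cases hcj : c j = 0
      · rw [hcj, zero_smul]
      · have := hcon j hcj
        rw [hrow₁ j this, hφ0 r (by omega) j this, smul_zero]
    refine ⟨hjr.trans_lt j.isLt, ?_⟩
    obtain ⟨S₂, h₂, hrow₂⟩ := exists_linear_combination S₁ j c hcj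
    rw [hc] at hrow₂
    let t : Fin m := ⟨r, hjr.trans_lt j.isLt⟩
    obtain ⟨S₃, h₃, hrow₃⟩ := exists_exchange S₂ t j
    have hmem : v r ∈ S₂.rowSpan := by
      have := S₂.row_mem_rowSpan j
      rwa [hrow₂, Function.update_self] at this
    have hother : ∀ i, i ≠ j → S₁.row i ∈ S₂.rowSpan := by
      intro i hi
      have := S₂.row_mem_rowSpan i
      rwa [hrow₂, Function.update_of_ne hi] at this
    have hspan₂ : S₂.rowSpan = S₁.rowSpan := by
      apply le_antisymm
      · refine Submodule.span_le.2 ?_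
        rintro _ ⟨i, rfl⟩
        by_cases hi : i = j
        · rw [hrow₂, hi, Function.update_self, hspan₁]
          exact hv r (by omega)
        · rw [hrow₂, Function.update_of_ne hi]
          exact S₁.row_mem_rowSpan i
      · refine Submodule.span_le.2 ?_
        rintro _ ⟨i, rfl⟩
        by_cases hi : i = j
        · subst hi
          have h1 := Finset.add_sum_erase Finset.univ (fun j => c j • S₁.row j) (Finset.mem_univ i)
          rw [hc] at h1
          have h2 : S₁.row i = (c i)⁻¹ • (v r - ∑ j ∈ Finset.univ.erase i, c j • S₁.row j) := by
            rw [← h1, add_sub_cancel_right, smul_smul, inv_mul_cancel₀ hcj, one_smul]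
          rw [h2]
          exact Submodule.smul_mem _ _ (Submodule.sub_mem _ hmem (Submodule.sum_mem _ fun j hj =>
            Submodule.smul_mem _ _ (hother j (Finset.ne_of_mem_erase hj))))
        · exact hother i hi
    have hspan₃ : S₃.rowSpan = S₂.rowSpan := by
      rw [SDP.rowSpan, hrow₃, (Equiv.swap t j).surjective.range_comp, SDP.rowSpan]
    refine ⟨S₃, (h₁.trans h₂).trans h₃, by rw [hspan₃, hspan₂, hspan₁], fun i hi => ?_⟩
    rw [hrow₃, Function.comp_apply]
    by_cases hit : i = t
    · rw [hit, Equiv.swap_apply_left, hrow₂, Function.update_self]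
    · have hir : (i : ℕ) < r := by
        have : (i : ℕ) ≠ r := fun h => hit (Fin.ext h)
        omega
      have hij : i ≠ j := fun h => by rw [h] at hir; omega
      rw [Equiv.swap_apply_of_ne_of_ne hit hij, hrow₂, Function.update_of_ne hij, hrow₁ i hir]

/-! ### Annihilators of the constraints -/

/-- A functional vanishing on the common kernel of finitely many functionals is a combination of
them; the nondegenerate pairing `Φ` transfers this to constraints. -/
theorem mem_rowSpan_of_annihilates (S : SDP n m) {G : Mat n} {β : ℝ}
    (h : ∀ X t, (∀ i, bullet (S.A i) X + S.b i * t = 0) → bullet G X + β * t = 0) :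
    (G, β) ∈ S.rowSpan := by
  let Φ : Mat n × ℝ →ₗ[ℝ] (Mat n × ℝ →ₗ[ℝ] ℝ) := LinearMap.mk₂ ℝ
    (fun p q => bullet p.1 q.1 + p.2 * q.2)
    (fun p p' q => by simp only [Prod.fst_add, Prod.snd_add, bullet_add_left]; ring)
    (fun c p q => by simp only [Prod.smul_fst, Prod.smul_snd, bullet_smul_left, smul_eq_mul]; ring)
    (fun p q q' => by simp only [Prod.fst_add, Prod.snd_add, bullet_add_right]; ring)
    (fun c p q => by simp only [Prod.smul_fst, Prod.smul_snd, bullet_smul_right, smul_eq_mul]; ring)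
  have hΦ : ∀ p q, Φ p q = bullet p.1 q.1 + p.2 * q.2 := fun p q => rfl
  have hinj : Function.Injective Φ := by
    rw [← LinearMap.ker_eq_bot, LinearMap.ker_eq_bot']
    intro p hp
    refine Prod.ext ?_ ?_
    · ext a b
      have := LinearMap.congr_fun hp (Matrix.single b a 1, 0)
      rw [hΦ] at this
      simpa [bullet, Matrix.trace_mul_single] using this
    · have := LinearMap.congr_fun hp (0, 1)
      rw [hΦ] at this
      simpa [bullet_zero_right] using this
  have hmem : Φ (G, β) ∈ Submodule.span ℝ (Set.range (Φ ∘ S.row)) := by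
    refine mem_span_of_iInf_ker_le_ker fun q hq => ?_
    rw [Submodule.mem_iInf] at hq
    exact h q.1 q.2 fun i => hq i
  rw [Set.range_comp, ← Submodule.map_span] at hmem
  obtain ⟨p, hp, hpG⟩ := hmem
  rwa [← hinj hpG]

theorem annihilates_of_mem_rowSpan (S : SDP n m) {X : Mat n} {t : ℝ}
    (h : ∀ i, bullet (S.A i) X + S.b i * t = 0) {p : Mat n × ℝ} (hp : p ∈ S.rowSpan) :
    bullet p.1 X + p.2 * t = 0 := by
  induction hp using Submodule.span_induction with
  | mem p hp => obtain ⟨i, rfl⟩ := hp; exact h i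
  | zero => simp [bullet_zero_left]
  | add p q _ _ hp hq =>
    rw [Prod.fst_add, Prod.snd_add, bullet_add_left]
    linarith
  | smul c p _ hp =>
    rw [Prod.smul_fst, Prod.smul_snd, bullet_smul_left, smul_eq_mul, mul_assoc, ← mul_add, hp,
      mul_zero]

open scoped MatrixOrder Matrix.Norms.L2Operator in
-- Factor `Y = Bᴴ B` and sum over the rows of `B`.
theorem mem_rankOneCone_of_posSemidef {Y : Mat n} (hY : Y.PosSemidef) : Y ∈ rankOneCone ⊤ := by
  obtain ⟨B, rfl⟩ := CStarAlgebra.nonneg_iff_eq_star_mul_self.1 hY.nonneg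
  rw [Matrix.star_eq_conjTranspose]
  have : Bᴴ * B = ∑ i, Matrix.vecMulVec (B i) (B i) := by
    ext a b
    simp [Matrix.mul_apply, Matrix.sum_apply, Matrix.vecMulVec_apply]
  rw [this]
  exact Submodule.sum_mem _ fun i _ => vecMulVec_mem_rankOneCone Submodule.mem_top

/-- A weakly infeasible SDP has no certificate of strong infeasibility. -/
theorem SDP.WeaklyInfeasible.notMem_rowSpan {S : SDP n m} (hS : S.WeaklyInfeasible) {G : Mat n}
    (hG : ∀ u, 0 ≤ u ⬝ᵥ G *ᵥ u) : (G, (-1 : ℝ)) ∉ S.rowSpan := by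
  intro hmem
  set c := ∑ a, ∑ b, |G a b|
  have hc : 0 ≤ c := Finset.sum_nonneg fun a _ => Finset.sum_nonneg fun b _ => abs_nonneg _
  -- Membership forces `G • X = -1` while `G • Y ≥ 0`; this radius keeps the two products less than
  -- `1` apart.
  obtain ⟨X, hX, Y, hY, hXY⟩ := hS.2 (1 / (c + 1)) (by positivity)
  have h1 := annihilates_of_mem_rowSpan S (X := X) (t := -1)
    (fun i => by rw [hX.2 i]; ring) hmem
  have h2 := bullet_nonneg_of_mem_rankOneCone (G := G) (fun u _ => hG u)
    (mem_rankOneCone_of_posSemidef hY)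
  have h3 := abs_le.1 (abs_bullet_le G (X - Y))
  rw [bullet_sub_right] at h3
  rw [lt_div_iff₀ (by positivity)] at hXY
  have h4 : c * frobNorm (X - Y) < 1 := by nlinarith [frobNorm_nonneg (X - Y)]
  simp only at h1
  linarith [h3.1]

/-! ### Weakly infeasible SDPs are possible outputs -/

/-- `A 0 • X j` is a sum over `P 0` of positive weights times diagonal entries of `X j`. Once `P 0`
misses the earlier `Q r`, these entries are nonnegative, and positive on `Q j`; a zero sum excludes
common indices. -/
theorem disjoint_of_bullet_first {P : Fin (k + 1) → Finset (Fin n)}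
    {Q : Fin l → Finset (Fin n)} {A : Fin (k + 1) → Mat n} {X : Fin l → Mat n}
    (hP : EchelonWith P A) (hQ : EchelonWith Q X) (h : ∀ j, bullet (A 0) (X j) = 0)
    (j : Fin l) : Disjoint (P 0) (Q j) := by
  induction j using WellFoundedLT.induction with
  | _ j ih =>
    have hterm : ∀ a ∈ P 0, a ∉ Q j → X j a a = 0 := fun a ha haj =>
      hQ.zero j a a (fun r hr => by
        have := Finset.disjoint_left.1 (ih r hr) ha
        exact ⟨this, this⟩) fun h' => haj h'.2
    have hnn : ∀ a ∈ P 0, 0 ≤ A 0 a a * X j a a := by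
      intro a ha
      refine mul_nonneg (hP.pos 0 a ha).le ?_
      by_cases haj : a ∈ Q j
      · exact (hQ.pos j a haj).le
      · exact (hterm a ha haj).ge
    have hsum := h j
    rw [hP.bullet_eq 0 (hQ.symm j) fun r hr => absurd hr (Fin.not_lt_zero r),
      Finset.sum_eq_zero_iff_of_nonneg hnn] at hsum
    rw [Finset.disjoint_left]
    intro a ha haj
    exact (mul_pos (hP.pos 0 a ha) (hQ.pos j a haj)).ne' (hsum a ha)

/-- Sequences that already satisfy the base equations are not changed by a suitable run of the
loop. -/
theorem loopRun_of_baseEquations {P : Fin (k + 1) → Finset (Fin n)}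
    {Q : Fin (l + 1) → Finset (Fin n)} {A : Fin (k + 1) → Mat n} {X : Fin (l + 1) → Mat n}
    (h : InitialChoice P Q A X) (hbase : BaseEquations A X) : ∀ s ≤ k, LoopRun P Q s A X := by
  intro s
  induction s with
  | zero => exact fun _ => .init A X h
  | succ s ih =>
    intro hs
    exact .step ⟨s, hs⟩ A X A X (ih (by omega)) ⟨fun _ _ => rfl, rfl, fun _ _ _ _ => rfl,
      fun _ _ _ _ _ => rfl, h.echelonA.symm _, fun _ => h.echelonX.symm _, fun _ => hbase _ _⟩

theorem baseEquations_loopChoice {P : Fin (k + 1) → Finset (Fin n)}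
    {Q : Fin (l + 1) → Finset (Fin n)} {A : Fin (k + 1) → Mat n} {X : Fin (l + 1) → Mat n}
    (hk : 1 ≤ k) (hl : 1 ≤ l) (hP : EchelonWith P A) (hQ : EchelonWith Q X)
    (hPne : ∀ i : Fin k, (P i.castSucc).Nonempty) (hQne : ∀ j : Fin l, (Q j.castSucc).Nonempty)
    (hbase : BaseEquations A X) : loopChoice n k l A X := by
  refine ⟨P, Q, loopRun_of_baseEquations ⟨hP, hQ, hPne, hQne, ?_, ?_⟩ hbase k le_rfl⟩
  · exact disjoint_of_bullet_first hP hQ fun j => by rw [hbase, baseRhs_zero_left hk]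
  · exact disjoint_of_bullet_first hQ hP fun i => by
      rw [bullet_comm, hbase, baseRhs_zero_right hl]

/-- The constraints of an SDP, as functionals on pairs `(X, t)`, have this common kernel. -/
def SDP.annihilator (S : SDP n m) : Submodule ℝ (Mat n × ℝ) where
  carrier := {q | ∀ i, bullet (S.A i) q.1 + S.b i * q.2 = 0}
  add_mem' := fun {p q} hp hq i => by
    have h1 := hp i
    have h2 := hq i
    rw [Prod.fst_add, Prod.snd_add, bullet_add_right]
    linarith
  zero_mem' := fun i => by simp [bullet_zero_right]
  smul_mem' := fun c p hp i => by
    have h1 := hp i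
    rw [Prod.smul_fst, Prod.smul_snd, bullet_smul_right, smul_eq_mul, mul_left_comm,
      ← mul_add, h1, mul_zero]

theorem SDP.transpose_mem_annihilator (S : SDP n m) {p : Mat n × ℝ} (hp : p ∈ S.annihilator) :
    (p.1ᵀ, p.2) ∈ S.annihilator := fun i => by
  change bullet (S.A i) p.1ᵀ + _ = 0
  rw [← bullet_transpose, (S.symm i).eq]
  exact hp i

theorem SDP.transpose_eq_of_mem_rowSpan (S : SDP n m) {p : Mat n × ℝ} (hp : p ∈ S.rowSpan) :
    p.1ᵀ = p.1 := by
  induction hp using Submodule.span_induction with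
  | mem p hp => obtain ⟨i, rfl⟩ := hp; exact S.symm i
  | zero => exact Matrix.transpose_zero
  | add p q _ _ hp hq => rw [Prod.fst_add, Matrix.transpose_add, hp, hq]
  | smul c p _ hp => rw [Prod.smul_fst, Matrix.transpose_smul, hp]

theorem SDP.congruence_mem_rowSpan {S S' : SDP n m} {T : Mat n}
    (hA : ∀ i, S'.A i = Tᵀ * S.A i * T) (hb : S'.b = S.b) {p : Mat n × ℝ} (hp : p ∈ S.rowSpan) :
    (Tᵀ * p.1 * T, p.2) ∈ S'.rowSpan := by
  induction hp using Submodule.span_induction with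
  | mem p hp =>
    obtain ⟨i, rfl⟩ := hp
    have := S'.row_mem_rowSpan i
    rwa [SDP.row, hA, hb] at this
  | zero => rw [Prod.fst_zero, Prod.snd_zero, mul_zero, zero_mul]; exact S'.rowSpan.zero_mem
  | add p q _ _ hp hq =>
    have := S'.rowSpan.add_mem hp hq
    rwa [Prod.mk_add_mk, ← add_mul, ← mul_add] at this
  | smul c p _ hp =>
    have := S'.rowSpan.smul_mem c hp
    rwa [Prod.smul_mk, ← Matrix.smul_mul, ← Matrix.mul_smul] at this

/-- A weakly infeasible SDP has two nontrivial reducing sequences: one proves that it is infeasible,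
and the other that it is not strongly infeasible. -/
theorem SDP.WeaklyInfeasible.exists_reducing_sequences {S : SDP n m} (hS : S.WeaklyInfeasible) :
    ∃ (k l : ℕ) (A X : ℕ → Mat n), 1 ≤ k ∧ 1 ≤ l ∧ (∀ i ≤ k, (A i).IsSymm) ∧
      (∀ i ≤ k, ∀ u ∈ radicalFlag ⊤ A i, 0 ≤ u ⬝ᵥ A i *ᵥ u) ∧
      (∀ i < k, radicalFlag ⊤ A (i + 1) < radicalFlag ⊤ A i) ∧
      (∀ i ≤ k, (A i, if i = k then (-1 : ℝ) else 0) ∈ S.rowSpan) ∧ (∀ j ≤ l, (X j).IsSymm) ∧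
      (∀ j ≤ l, ∀ u ∈ radicalFlag ⊤ X j, 0 ≤ u ⬝ᵥ X j *ᵥ u) ∧
      (∀ j < l, radicalFlag ⊤ X (j + 1) < radicalFlag ⊤ X j) ∧
      ∀ j ≤ l, ∀ i, bullet (S.A i) (X j) + S.b i * (if j = l then -1 else 0) = 0 := by
  obtain ⟨k, A, hA, hApos, hAann, hAlt⟩ := exists_facial_reduction S.annihilator
    (fun p hp => S.transpose_mem_annihilator hp) ⊤
    (fun X hX hmem => hS.1 ⟨X, ⟨by
        simpa [Matrix.IsHermitian, Matrix.IsSymm] using (posSemidef_of_mem_rankOneCone hX).1,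
      fun i => by
        have : bullet (S.A i) X + S.b i * (-1) = 0 := hmem i
        linarith⟩, posSemidef_of_mem_rankOneCone hX⟩)
  have hAmem : ∀ i ≤ k, (A i, if i = k then (-1 : ℝ) else 0) ∈ S.rowSpan := fun i hi =>
    mem_rowSpan_of_annihilates S fun X t hXt => hAann i hi (X, t) hXt
  -- Here the excluded matrices are the certificates of strong infeasibility, and the new sequence
  -- annihilates the constraints themselves.
  obtain ⟨l, X, hX, hXpos, hXann, hXlt⟩ := exists_facial_reduction S.rowSpan
    (fun p hp => by rwa [S.transpose_eq_of_mem_rowSpan hp]) ⊤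
    (fun G hG => hS.notMem_rowSpan fun u => by
      simpa using (posSemidef_of_mem_rankOneCone hG).dotProduct_mulVec_nonneg u)
  have hXrow : ∀ j ≤ l, ∀ i, bullet (S.A i) (X j) + S.b i * (if j = l then -1 else 0) = 0 :=
    fun j hj i => by
      have := hXann j hj _ (S.row_mem_rowSpan i)
      rw [bullet_comm, mul_comm (S.b i)]
      exact this
  refine ⟨k, l, A, X, ?_, ?_, hA, hApos, hAlt, hAmem, hX, hXpos, hXlt, hXrow⟩
  -- Length zero would make `A 0` a certificate of strong infeasibility; in the dual case, `X 0`
  -- would be a feasible solution.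
  · by_contra! h0
    obtain rfl : k = 0 := by omega
    exact hS.notMem_rowSpan (fun u => hApos 0 le_rfl u Submodule.mem_top) (hAmem 0 le_rfl)
  · by_contra! h0
    obtain rfl : l = 0 := by omega
    refine hS.1 ⟨X 0, ⟨hX 0 le_rfl, fun i => ?_⟩, ?_⟩
    · have := hXrow 0 le_rfl i
      rw [if_pos rfl] at this
      linarith
    · refine Matrix.PosSemidef.of_dotProduct_mulVec_nonneg ?_ fun u => ?_
      · simpa [Matrix.IsHermitian, Matrix.IsSymm] using hX 0 le_rfl
      · simpa using hXpos 0 le_rfl u Submodule.mem_top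

/-- An echelon sequence in the span of the constraints can be made the head of the constraints. -/
theorem exists_head_reformulation (S : SDP n m) {P : Fin (k + 1) → Finset (Fin n)} {A : ℕ → Mat n}
    (hP : EchelonWith P fun i => A i) (hPne : ∀ i : Fin k, (P i.castSucc).Nonempty)
    (hA : ∀ i ≤ k, (A i, if i = k then (-1 : ℝ) else 0) ∈ S.rowSpan) :
    k + 1 ≤ m ∧ ∃ S' : SDP n m, Reformulates S S' ∧ S'.rowSpan = S.rowSpan ∧
      ∀ i : Fin m, (i : ℕ) < k + 1 →
        S'.A i = A i ∧ S'.b i = if (i : ℕ) = k then -1 else 0 := by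
  choose a ha using hPne
  -- Level `i < k` is detected by a diagonal entry in `P i`, where all earlier matrices vanish; the
  -- last level is detected by its right hand side, the only nonzero one.
  let φ : ℕ → Mat n × ℝ →ₗ[ℝ] ℝ := fun i =>
    if hi : i < k then
      Matrix.entryLinearMap ℝ ℝ (a ⟨i, hi⟩) (a ⟨i, hi⟩) ∘ₗ LinearMap.fst ℝ (Mat n) ℝ
    else LinearMap.snd ℝ (Mat n) ℝ
  obtain ⟨hm, S', h, hspan, hrow⟩ := exists_row_reformulation S
    (fun i => (A i, if i = k then (-1 : ℝ) else 0)) φ (k + 1) (fun i hi => hA i (by omega))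
    (fun i hi => by
      by_cases hik : i < k
      · simp only [φ, dif_pos hik]
        exact (hP.pos _ _ (ha ⟨i, hik⟩)).ne'
      · have : i = k := by omega
        simp [φ, this])
    (fun i hi j hj => by
      by_cases hik : i < k
      · simp only [φ, dif_pos hik]
        have hnot : ∀ s : Fin (k + 1), (s : ℕ) ≤ j → a ⟨i, hik⟩ ∉ P s := fun s hs =>
          Finset.disjoint_right.1 (hP.disjoint s _ fun e => by
            have := congrArg Fin.val e
            simp at this
            omega) (ha ⟨i, hik⟩)
        exact hP.zero ⟨j, by omega⟩ _ _ (fun s hs => by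
          have := hnot s (Fin.lt_def.1 hs).le
          exact ⟨this, this⟩) fun h' => hnot ⟨j, by omega⟩ le_rfl h'.2
      · simp [φ, hik, show j ≠ k by omega])
  exact ⟨hm, S', h, hspan, fun i hi => Prod.ext_iff.1 (hrow i hi)⟩

theorem exists_rotation (S : SDP n m) {T : Mat n} (hT : IsUnit T) :
    ∃ S' : SDP n m, ReformStep S S' ∧ (∀ i, S'.A i = Tᵀ * S.A i * T) ∧ S'.b = S.b := by
  let S' : SDP n m := ⟨fun i => Tᵀ * S.A i * T, S.b, fun i => by
    have := S.symm i
    simp only [Matrix.IsSymm, Matrix.transpose_mul, Matrix.transpose_transpose] at this ⊢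
    rw [this, Matrix.mul_assoc]⟩
  exact ⟨S', .rotate S S' T hT (fun _ => rfl) rfl, fun _ => rfl, rfl⟩

/-- The products with the `X` sequence depend only on the span of the constraints, so they survive
the row operations that move `A` to the head. -/
theorem SDP.WeaklyInfeasible.possibleOutput {S : SDP n m} (hS : S.WeaklyInfeasible) :
    PossibleOutput (loopChoice n) S := by
  obtain ⟨k, l, A, X, hk, hl, hA, hApos, hAlt, hAmem, hX, hXpos, hXlt, hXrow⟩ :=
    hS.exists_reducing_sequences
  obtain ⟨T, R, P, Q, hTR, hP, hQ, hPne, hQne⟩ :=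
    exists_simultaneous_echelon hA hApos hAlt hX hXpos hXlt
  obtain ⟨S₁, h₁, hS₁A, hS₁b⟩ := exists_rotation S (IsUnit.of_mul_eq_one R hTR)
  have hmem₁ : ∀ i ≤ k, (Tᵀ * A i * T, if i = k then (-1 : ℝ) else 0) ∈ S₁.rowSpan := fun i hi =>
    SDP.congruence_mem_rowSpan (p := (A i, if i = k then (-1 : ℝ) else 0)) hS₁A hS₁b (hAmem i hi)
  have hX₁ : ∀ j ≤ l, ∀ p ∈ S₁.rowSpan,
      bullet p.1 (R * X j * Rᵀ) + p.2 * (if j = l then -1 else 0) = 0 := fun j hj p hp =>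
    annihilates_of_mem_rowSpan S₁ (fun i => by
      rw [hS₁A, hS₁b, bullet_congruence _ _ _ _ hTR]
      exact hXrow j hj i) hp
  obtain ⟨hm, S₂, h₂, hspan, hrow⟩ :=
    exists_head_reformulation S₁ (A := fun i => Tᵀ * A i * T) hP hPne hmem₁
  have hS₂ : ∀ j ≤ l, ∀ i,
      bullet (S₂.A i) (R * X j * Rᵀ) + S₂.b i * (if j = l then -1 else 0) = 0 := by
    intro j hj i
    have hi := S₂.row_mem_rowSpan i
    rw [hspan] at hi
    exact hX₁ j hj _ hi
  have hbase : BaseEquations (fun i : Fin (k + 1) => Tᵀ * A i * T)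
      (fun j : Fin (l + 1) => R * X j * Rᵀ) := by
    intro i j
    have h0 := hX₁ j (by omega) _ (hmem₁ i (by omega))
    have hi : i = Fin.last k ↔ (i : ℕ) = k := by rw [Fin.ext_iff, Fin.val_last]
    have hj : j = Fin.last l ↔ (j : ℕ) = l := by rw [Fin.ext_iff, Fin.val_last]
    rw [eq_neg_of_add_eq_zero_left h0, baseRhs]
    simp only [hi, hj]
    by_cases hik : (i : ℕ) = k <;> by_cases hjl : (j : ℕ) = l <;> simp [hik, hjl]
  have hassembles : Assembles hm (fun i : Fin (k + 1) => Tᵀ * A i * T)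
      (fun j : Fin (l + 1) => R * X j * Rᵀ) S₂ := by
    constructor
    · exact fun i => (hrow (Fin.castLE hm i) i.isLt).1
    · intro i
      rw [(hrow (Fin.castLE hm i) i.isLt).2]
      simp only [Fin.ext_iff, Fin.val_last, Fin.val_castLE]
    · intro i _ j
      have := hS₂ j j.isLt.le i
      rwa [if_neg j.isLt.ne, mul_zero, add_zero] at this
    · intro i _
      have := hS₂ l le_rfl i
      rw [if_pos rfl] at this
      simp only [Fin.val_last]
      linarith
  exact ⟨k, l, hk, hl, hm, _, _, baseEquations_loopChoice hk hl hP hQ hPne hQne hbase, S₂,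
    hassembles, Reformulates.symm (.head h₁ h₂)⟩

/-! ### Outputs are weakly infeasible, for either choice of sequences -/

theorem PossibleOutput.weaklyInfeasible {S : SDP n m} (h : PossibleOutput (anyChoice n) S) :
    S.WeaklyInfeasible := by
  obtain ⟨k, l, -, -, hm, A, X, ⟨hA, hX, hbase⟩, S₀, hS₀, href⟩ := h
  exact href.weaklyInfeasible (hS₀.weaklyInfeasible hA hX hbase)

theorem LoopRun.result {P : Fin (k + 1) → Finset (Fin n)} {Q : Fin (l + 1) → Finset (Fin n)}
    (hk : 1 ≤ k) (hl : 1 ≤ l) {A : Fin (k + 1) → Mat n} {X : Fin (l + 1) → Mat n}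
    (h : LoopRun P Q k A X) : EchelonWith P A ∧ EchelonWith Q X ∧ BaseEquations A X := by
  obtain ⟨hinit, heq⟩ := h.invariant hk hl
  exact ⟨hinit.echelonA, hinit.echelonX, fun i j => heq i (by omega) j⟩

theorem PossibleOutput.anyChoice_of_loopChoice {S : SDP n m}
    (h : PossibleOutput (loopChoice n) S) : PossibleOutput (anyChoice n) S := by
  obtain ⟨k, l, hk, hl, hm, A, X, ⟨P, Q, hrun⟩, hS⟩ := h
  obtain ⟨hP, hQ, hbase⟩ := hrun.result hk hl
  exact ⟨k, l, hk, hl, hm, A, X, ⟨⟨P, hP⟩, ⟨Q, hQ⟩, hbase⟩, hS⟩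

end WeakSDP

/-- First part: the base equations algorithm never gets stuck, and each completed run yields echelon
sequences that satisfy the base equations, from which an SDP with any number `m ≥ k + 1` of
constraints can be assembled. Second part: the possible outputs of the construction, whether its
echelon sequences are chosen in any way or by the base equations algorithm, are exactly the weakly
infeasible SDPs. -/
theorem theorem2 (n m : ℕ) :
    (∀ k l : ℕ, 1 ≤ k → 1 ≤ l →
      ∀ (P : Fin (k + 1) → Finset (Fin n)) (Q : Fin (l + 1) → Finset (Fin n)),
        (∀ (t : Fin k) (A : Fin (k + 1) → WeakSDP.Mat n) (X : Fin (l + 1) → WeakSDP.Mat n),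
          WeakSDP.LoopRun P Q (t : ℕ) A X → ∃ A' X', WeakSDP.LoopStep P Q t A X A' X') ∧
        (∀ (A : Fin (k + 1) → WeakSDP.Mat n) (X : Fin (l + 1) → WeakSDP.Mat n),
          WeakSDP.LoopRun P Q k A X →
            WeakSDP.EchelonWith P A ∧ WeakSDP.EchelonWith Q X ∧ WeakSDP.BaseEquations A X ∧
            ∀ hm : k + 1 ≤ m, ∃ S : WeakSDP.SDP n m, WeakSDP.Assembles hm A X S)) ∧
    (∀ S : WeakSDP.SDP n m,
      (WeakSDP.PossibleOutput (WeakSDP.anyChoice n) S ↔ S.WeaklyInfeasible) ∧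
      (WeakSDP.PossibleOutput (WeakSDP.loopChoice n) S ↔ S.WeaklyInfeasible)) := by
  refine ⟨fun k l hk hl P Q => ⟨fun t A X h => ?_, fun A X h => ?_⟩, fun S => ⟨?_, ?_⟩⟩
  · exact (h.invariant hk hl).1.exists_loopStep hl t
  · obtain ⟨hP, hQ, hbase⟩ := h.result hk hl
    exact ⟨hP, hQ, hbase, fun hm => WeakSDP.exists_assembles hm A X hP.symm⟩
  · exact ⟨fun h => h.weaklyInfeasible, fun h => h.possibleOutput.anyChoice_of_loopChoice⟩
  · exact ⟨fun h => h.anyChoice_of_loopChoice.weaklyInfeasible, fun h => h.possibleOutput⟩
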